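/- Let $\mathcal A$ be an exact category in the sense of Quillen. Write $\operatorname{Iso}\mathcal A$ for the set of isomorphism classes $[X]$ of its objects, and $\mathcal E(A,B)_X$ for the set of all short exact sequences $B\rightarrowtail X\twoheadrightarrow A$ of $\mathcal A$. Let $\Gamma_{\mathcal A}$ be the Grothendieck monoid: the quotient of $\operatorname{Iso}\mathcal A$ (a monoid under $\oplus$) by the equivalence relation generated by $[X]\equiv[Y]$ whenever $X$ and $Y$ are both middle terms of short exact sequences with the same end terms, i.e. $\mathcal E(A,B)_X\neq\emptyset\neq\mathcal E(A,B)_Y$ for some $A,B$. Assume that * all sets $\operatorname{Hom}_{\mathcal A}(X,Y)$ are finite; * $\mathcal A$ is profinitary: each fibre of $\operatorname{Iso}\mathcal A\to\Gamma_{\mathcal A}$ is finite; * $\mathcal A$ is cofinitary: for every $X$ the set of pairs $([A],[B])$ with $\mathcal E(A,B)_X\ne\emptyset$ is finite. Let $H_{\mathcal A}=\bigoplus_{[X]\in\operatorname{Iso}\mathcal A}\mathbb Q\,[X]$ be the Hall algebra, i.e. the associative $\mathbb Q$-algebra with unit $1=[0]$ and product $$[A]\cdot[B]=\sum_{[C]}F_{A,B}^C\,[C],\qquad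 F_{A,B}^C=\frac{\#\mathcal E(A,B)_C}{\#\operatorname{Aut}A\cdot\#\operatorname{Aut}B},$$ with the coalgebra structure $$\Delta([C])=\sum_{[A],[B]}F^{A,B}_C\,[A]\otimes[B],\qquad F^{A,B}_C=\frac{\#\operatorname{Aut}A\cdot\#\operatorname{Aut}B}{\#\operatorname{Aut}C}\,F_{B,A}^C,\qquad \varepsilon([C])=\delta_{[0],[C]}.$$ Let $V_{\mathcal A}=\{v\in H_{\mathcal A}:\Delta(v)=v\otimes1+1\otimes v\}$ be the space of primitive elements, and let $V_{\mathcal A}^r$ be the span of all products of $r$ elements of $V_{\mathcal A}$. Then: 1. $H_{\mathcal A}$ is generated by $V_{\mathcal A}$ as a unital $\mathbb Q$-algebra; 2. $V_{\mathcal A}$ is minimal: no non-zero element of $V_{\mathcal A}$ lies in $\sum_{r>1}V_{\mathcal A}^r$, i.e. is a sum of products of at least two elements of $V_{\mathcal A}$; 3. $H_{\mathcal A}$ is quasi-Nichols: $H_{\mathcal A}=\mathbb Q\oplus V_{\mathcal A}\oplus\big(\sum_{r>1}V_{\mathcal A}^r\big)$, where $\mathbb Q=\mathbb Q\cdot 1$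 and the sum of these three subspaces is direct. -/

import Mathlib

open CategoryTheory CategoryTheory.Limits
open scoped TensorProduct

namespace Hall

section ExactCategories

variable {C : Type*} [Category C] [Preadditive C]

/-- The first maps of the short complexes in a given class. -/
def IsInflation (P : ShortComplex C → Prop) {X Y : C} (i : X ⟶ Y) : Prop :=
  ∃ (Z : C) (p : Y ⟶ Z) (w : i ≫ p = 0), P (ShortComplex.mk i p w)

/-- The second maps of the short complexes in a given class. -/
def IsDeflation (P : ShortComplex C → Prop) {Y Z : C} (p : Y ⟶ Z) : Prop :=
  ∃ (X : C) (i : X ⟶ Y) (w : i ≫ p = 0), P (ShortComplex.mk i p w)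

/-- An exact structure (in the sense of Quillen, with the axioms in the form given by Keller and
Bühler) on an additive category. The conflations are the distinguished short exact sequences,
their first maps are the admissible monomorphisms and their second maps the admissible
epimorphisms. -/
class ExactStructure (C : Type*) [Category C] [Preadditive C] [HasZeroObject C]
    [HasBinaryBiproducts C] where
  Conflation : ShortComplex C → Prop
  of_iso : ∀ {S T : ShortComplex C}, (S ≅ T) → Conflation S → Conflation T
  isKernel : ∀ {S : ShortComplex C}, Conflation S →
    Nonempty (IsLimit (KernelFork.ofι S.f S.zero))
  isCokernel : ∀ {S : ShortComplex C}, Conflation S →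
    Nonempty (IsColimit (CokernelCofork.ofπ S.g S.zero))
  inflation_id : ∀ X : C, IsInflation Conflation (𝟙 X)
  deflation_id : ∀ X : C, IsDeflation Conflation (𝟙 X)
  inflation_comp : ∀ {X Y Z : C} (i : X ⟶ Y) (j : Y ⟶ Z),
    IsInflation Conflation i → IsInflation Conflation j → IsInflation Conflation (i ≫ j)
  deflation_comp : ∀ {X Y Z : C} (p : X ⟶ Y) (q : Y ⟶ Z),
    IsDeflation Conflation p → IsDeflation Conflation q → IsDeflation Conflation (p ≫ q)
  inflation_pushout : ∀ {X Y X' : C} (i : X ⟶ Y) (f : X ⟶ X'), IsInflation Conflation i →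
    ∃ (Y' : C) (f' : Y ⟶ Y') (i' : X' ⟶ Y'), IsPushout i f f' i' ∧ IsInflation Conflation i'
  deflation_pullback : ∀ {Y Z Z' : C} (p : Y ⟶ Z) (f : Z' ⟶ Z), IsDeflation Conflation p →
    ∃ (Y' : C) (f' : Y' ⟶ Y) (p' : Y' ⟶ Z'), IsPullback f' p' p f ∧ IsDeflation Conflation p'

end ExactCategories

section IsoClasses

/-- The set of isomorphism classes of objects. -/
def IsoClass (C : Type*) [Category C] : Type _ := Quotient (isIsomorphicSetoid C)

variable {C : Type*} [Category C]

/-- The isomorphism class of an object. -/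
def cls (X : C) : IsoClass C := Quotient.mk (isIsomorphicSetoid C) X

/-- A chosen object of an isomorphism class. -/
noncomputable def rep (x : IsoClass C) : C := Quotient.out x

@[simp] lemma cls_rep (x : IsoClass C) : cls (rep x) = x := Quotient.out_eq x

lemma cls_eq_iff {X Y : C} : cls X = cls Y ↔ Nonempty (X ≅ Y) :=
  ⟨fun h => Quotient.exact h, fun h => Quotient.sound h⟩

lemma nonempty_iso_rep (X : C) : Nonempty (rep (cls X) ≅ X) := cls_eq_iff.1 (by simp)

lemma eq_of_iso_rep {x y : IsoClass C} (h : rep x ≅ rep y) : x = y := by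
  rw [← cls_rep x, ← cls_rep y]; exact cls_eq_iff.2 ⟨h⟩

end IsoClasses

section Sequences

variable {C : Type*} [Category C] [Preadditive C] [HasZeroObject C] [HasBinaryBiproducts C]
  [ExactStructure C]

/-- `IsConfl f g` says that `B --f--> X --g--> A` is a short exact sequence of the exact
category. -/
def IsConfl {B X A : C} (f : B ⟶ X) (g : X ⟶ A) : Prop :=
  ∃ w : f ≫ g = 0, ExactStructure.Conflation (ShortComplex.mk f g w)

/-- The set of all short exact sequences `B ⟶ X ⟶ A`. -/
def ShortExacts (A B X : C) : Set ((B ⟶ X) × (X ⟶ A)) := {p | IsConfl p.1 p.2}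

/-- The set of isomorphism classes of middle terms of short exact sequences `B ⟶ X ⟶ A`. -/
def extClasses (A B : C) : Set (IsoClass C) :=
  {x | ∃ X : C, cls X = x ∧ (ShortExacts A B X).Nonempty}

end Sequences

section Finiteness

/-- All morphism sets are finite. -/
class HomFinite (C : Type*) [Category C] : Prop where
  finite_hom : ∀ X Y : C, Finite (X ⟶ Y)

attribute [instance] HomFinite.finite_hom

variable (C : Type*) [Category C] [Preadditive C] [HasZeroObject C] [HasBinaryBiproducts C]
  [ExactStructure C]

/-- The set underlying the Grothendieck monoid: the quotient of the set of isomorphism classes by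
the equivalence relation generated by identifying any two middle terms of short exact sequences
with the same end terms. -/
def GrothendieckMonoid : Type _ :=
  Quot fun x y : IsoClass C => ∃ M N : C, x ∈ extClasses M N ∧ y ∈ extClasses M N

variable {C} in
/-- The class of an object in the Grothendieck monoid. -/
def grothendieckClass (x : IsoClass C) : GrothendieckMonoid C := Quot.mk _ x

/-- A finitary exact category. -/
class Finitary : Prop extends HomFinite C where
  finite_ext : ∀ A B : C, (extClasses A B).Finite

/-- A profinitary exact category: it is Hom-finite with finite Grothendieck classes. -/
class Profinitary : Prop extends HomFinite C where
  finite_class : ∀ γ : GrothendieckMonoid C, {x : IsoClass C | grothendieckClass x = γ}.Finite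

/-- A cofinitary exact category: it is Hom-finite and each object is, up to isomorphism, the
middle term of short exact sequences with only finitely many pairs of end terms. -/
class Cofinitary : Prop extends HomFinite C where
  finite_coext : ∀ X : C,
    {p : IsoClass C × IsoClass C | ∃ A B : C, p = (cls A, cls B) ∧ cls X ∈ extClasses A B}.Finite

instance (priority := 100) Profinitary.finitary [Profinitary C] : Finitary C where
  finite_ext A B := by
    rcases (extClasses A B).eq_empty_or_nonempty with h | ⟨x, hx⟩
    · simp [h]
    · exact (Profinitary.finite_class (grothendieckClass x)).subset
        fun y hy => Quot.sound ⟨A, B, hy, hx⟩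

end Finiteness

section Conflations

variable {C : Type*} [Category C] [Preadditive C] [HasZeroObject C] [HasBinaryBiproducts C]
  [ExactStructure C]

namespace IsConfl

variable {B X A : C} {f : B ⟶ X} {g : X ⟶ A}

lemma zero (h : IsConfl f g) : f ≫ g = 0 := h.1

lemma mono (h : IsConfl f g) : Mono f := by
  obtain ⟨w, h⟩ := h
  exact mono_of_isLimit_fork (ExactStructure.isKernel h).some

lemma epi (h : IsConfl f g) : Epi g := by
  obtain ⟨w, h⟩ := h
  exact epi_of_isColimit_cofork (ExactStructure.isCokernel h).some

lemma lift (h : IsConfl f g) {W : C} (u : W ⟶ X) (hu : u ≫ g = 0) : ∃ v : W ⟶ B, v ≫ f = u := by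
  obtain ⟨w, h⟩ := h
  exact ⟨_, (KernelFork.IsLimit.lift' (ExactStructure.isKernel h).some u hu).2⟩

lemma desc (h : IsConfl f g) {W : C} (u : X ⟶ W) (hu : f ≫ u = 0) : ∃ v : A ⟶ W, g ≫ v = u := by
  obtain ⟨w, h⟩ := h
  exact ⟨_, (CokernelCofork.IsColimit.desc' (ExactStructure.isCokernel h).some u hu).2⟩

lemma inflation (h : IsConfl f g) : IsInflation (ExactStructure.Conflation (C := C)) f :=
  ⟨_, g, h.1, h.2⟩

lemma deflation (h : IsConfl f g) : IsDeflation (ExactStructure.Conflation (C := C)) g :=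
  ⟨_, f, h.1, h.2⟩

lemma of_iso (h : IsConfl f g) {B' X' A' : C} {f' : B' ⟶ X'} {g' : X' ⟶ A'}
    (b : B ≅ B') (x : X ≅ X') (a : A ≅ A') (hf : b.hom ≫ f' = f ≫ x.hom)
    (hg : x.hom ≫ g' = g ≫ a.hom) : IsConfl f' g' := by
  obtain ⟨w, h⟩ := h
  have w' : f' ≫ g' = 0 := by
    rw [← cancel_epi b.hom, reassoc_of% hf, hg, reassoc_of% w]; simp
  exact ⟨w', ExactStructure.of_iso (ShortComplex.isoMk b x a hf hg) h⟩

/-- Two kernels of the same map differ by an isomorphism. -/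
lemma kernel_iso (h : IsConfl f g) {B' : C} {f' : B' ⟶ X} (h' : IsConfl f' g) :
    ∃ e : B' ≅ B, e.hom ≫ f = f' := by
  obtain ⟨u, hu⟩ := h.lift f' h'.zero
  obtain ⟨v, hv⟩ := h'.lift f h.zero
  have := h.mono
  have := h'.mono
  exact ⟨⟨u, v, by rw [← cancel_mono f']; simp [hu, hv], by rw [← cancel_mono f]; simp [hu, hv]⟩,
    hu⟩

lemma cokernel_iso (h : IsConfl f g) {A' : C} {g' : X ⟶ A'} (h' : IsConfl f g') :
    ∃ e : A ≅ A', g ≫ e.hom = g' := by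
  obtain ⟨u, hu⟩ := h.desc g' h'.zero
  obtain ⟨v, hv⟩ := h'.desc g h.zero
  have := h.epi
  have := h'.epi
  refine ⟨⟨u, v, ?_, ?_⟩, hu⟩
  · rw [← cancel_epi g, reassoc_of% hu, hv]; simp
  · rw [← cancel_epi g', reassoc_of% hv, hu]; simp

end IsConfl

lemma IsDeflation.isConfl {X A : C} {g : X ⟶ A}
    (hg : IsDeflation (ExactStructure.Conflation (C := C)) g) :
    ∃ (B : C) (f : B ⟶ X), IsConfl f g := by
  obtain ⟨B, f, w, h⟩ := hg; exact ⟨B, f, w, h⟩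

lemma IsInflation.isConfl {B X : C} {f : B ⟶ X}
    (hf : IsInflation (ExactStructure.Conflation (C := C)) f) :
    ∃ (A : C) (g : X ⟶ A), IsConfl f g := by
  obtain ⟨A, g, w, h⟩ := hf; exact ⟨A, g, w, h⟩

/-- A deflation together with any kernel of it is a short exact sequence. -/
lemma IsDeflation.isConfl_of_kernel {B X A : C} {f : B ⟶ X} {g : X ⟶ A}
    (hg : IsDeflation (ExactStructure.Conflation (C := C)) g) (w : f ≫ g = 0) (hf : Mono f)
    (hl : ∀ {W : C} (u : W ⟶ X), u ≫ g = 0 → ∃ v : W ⟶ B, v ≫ f = u) : IsConfl f g := by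
  obtain ⟨B', f', h⟩ := hg.isConfl
  obtain ⟨u, hu⟩ := h.lift f w
  obtain ⟨v, hv⟩ := hl f' h.zero
  have := h.mono
  exact h.of_iso (f' := f) (g' := g)
    ⟨v, u, by rw [← cancel_mono f']; simp [hu, hv], by rw [← cancel_mono f]; simp [hu, hv]⟩
    (Iso.refl _) (Iso.refl _) (by simp [hv]) (by simp)

lemma IsInflation.isConfl_of_cokernel {B X A : C} {f : B ⟶ X} {g : X ⟶ A}
    (hf : IsInflation (ExactStructure.Conflation (C := C)) f) (w : f ≫ g = 0) (hg : Epi g)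
    (hl : ∀ {W : C} (u : X ⟶ W), f ≫ u = 0 → ∃ v : A ⟶ W, g ≫ v = u) : IsConfl f g := by
  obtain ⟨A', g', h⟩ := hf.isConfl
  obtain ⟨u, hu⟩ := h.desc g w
  obtain ⟨v, hv⟩ := hl g' h.zero
  have := h.epi
  refine h.of_iso (f' := f) (g' := g) (Iso.refl _) (Iso.refl _) ⟨u, v, ?_, ?_⟩ (by simp)
    (by simp [hu])
  · rw [← cancel_epi g', reassoc_of% hu, hv]; simp
  · rw [← cancel_epi g, reassoc_of% hv, hu]; simp

lemma IsDeflation.of_isPullback {Y Z Z' Y' : C} {p : Y ⟶ Z} {f : Z' ⟶ Z} {f' : Y' ⟶ Y}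
    {p' : Y' ⟶ Z'} (hp : IsDeflation (ExactStructure.Conflation (C := C)) p)
    (h : IsPullback f' p' p f) : IsDeflation (ExactStructure.Conflation (C := C)) p' := by
  obtain ⟨Y'', f'', p'', h', hd⟩ := ExactStructure.deflation_pullback p f hp
  obtain ⟨K, k, hk⟩ := hd.isConfl
  let e := h'.isoIsPullback _ _ h
  exact (hk.of_iso (f' := k ≫ e.hom) (g' := p') (Iso.refl _) e (Iso.refl _) (by simp)
    (by simp [e])).deflation

lemma IsInflation.of_isPushout {X Y X' Y' : C} {i : X ⟶ Y} {f : X ⟶ X'} {f' : Y ⟶ Y'}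
    {i' : X' ⟶ Y'} (hi : IsInflation (ExactStructure.Conflation (C := C)) i)
    (h : IsPushout i f f' i') : IsInflation (ExactStructure.Conflation (C := C)) i' := by
  obtain ⟨Y'', f'', i'', h', hd⟩ := ExactStructure.inflation_pushout i f hi
  obtain ⟨K, k, hk⟩ := hd.isConfl
  let e := h'.isoIsPushout _ _ h
  exact (hk.of_iso (f' := i') (g' := e.inv ≫ k) (Iso.refl _) e (Iso.refl _) (by simp [e])
    (by simp)).inflation

/-- Given `B ⟶ X ⟶ A` and `D ⟶ Y ⟶ X` with composite deflation `Y ⟶ A`, any kernel `Z` of the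
latter sits in a short exact sequence `D ⟶ Z ⟶ B`. -/
lemma exists_of_quot {A B D X Y Z : C} {i : B ⟶ X} {p : X ⟶ A} {j : D ⟶ Y} {q : Y ⟶ X}
    {m : Z ⟶ Y} (h₁ : IsConfl i p) (h₂ : IsConfl j q) (h₃ : IsConfl m (q ≫ p)) :
    ∃ (k : D ⟶ Z) (l : Z ⟶ B), IsConfl k l ∧ k ≫ m = j ∧ m ≫ q = l ≫ i := by
  obtain ⟨l, hl⟩ := h₁.lift (m ≫ q) (by simpa using h₃.zero)
  obtain ⟨k, hk⟩ := h₃.lift j (by rw [reassoc_of% h₂.zero]; simp)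
  have := h₁.mono
  have := h₂.mono
  have := h₃.mono
  have hp : IsPullback m l q i := by
    refine ⟨⟨hl.symm⟩, ⟨PullbackCone.IsLimit.mk _
      (fun s => (h₃.lift s.fst (by rw [reassoc_of% s.condition, h₁.zero]; simp)).choose)
      (fun s => (h₃.lift s.fst (by rw [reassoc_of% s.condition, h₁.zero]; simp)).choose_spec)
      (fun s => ?_) (fun s u hu _ => ?_)⟩⟩
    · have e := (h₃.lift s.fst (by rw [reassoc_of% s.condition, h₁.zero]; simp)).choose_spec
      rw [← cancel_mono i, Category.assoc, hl, reassoc_of% e, s.condition]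
    · have e := (h₃.lift s.fst (by rw [reassoc_of% s.condition, h₁.zero]; simp)).choose_spec
      rw [← cancel_mono m, hu, e]
  have hkl : k ≫ l = 0 := by
    rw [← cancel_mono i, Category.assoc, hl, reassoc_of% hk, h₂.zero]; simp
  have hkm : Mono k := by
    have : Mono (k ≫ m) := by rw [hk]; infer_instance
    exact mono_of_mono k m
  refine ⟨k, l, (h₂.deflation.of_isPullback hp).isConfl_of_kernel hkl hkm fun u hu => ?_, hk,
    hl.symm⟩
  obtain ⟨v, hv⟩ := h₂.lift (u ≫ m) (by rw [Category.assoc, ← hl, reassoc_of% hu]; simp)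
  exact ⟨v, by rw [← cancel_mono m, Category.assoc, hk, hv]⟩

lemma exists_of_sub {A B D X Y Z : C} {k : D ⟶ Z} {l : Z ⟶ B} {m : Z ⟶ Y} {n : Y ⟶ A}
    {q : Y ⟶ X} (h₁ : IsConfl k l) (h₂ : IsConfl m n) (h₃ : IsConfl (k ≫ m) q) :
    ∃ (i : B ⟶ X) (p : X ⟶ A), IsConfl i p ∧ q ≫ p = n ∧ m ≫ q = l ≫ i := by
  obtain ⟨i, hi⟩ := h₁.desc (m ≫ q) (by simpa using h₃.zero)
  obtain ⟨p, hp⟩ := h₃.desc n (by rw [Category.assoc, h₂.zero]; simp)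
  have := h₁.epi
  have := h₂.epi
  have := h₃.epi
  have hs : ∀ s : PushoutCocone m l, (k ≫ m) ≫ s.inl = 0 := fun s => by
    rw [Category.assoc, s.condition, reassoc_of% h₁.zero]; simp
  have hP : IsPushout m l q i := by
    refine ⟨⟨hi.symm⟩, ⟨PushoutCocone.IsColimit.mk _
      (fun s => (h₃.desc s.inl (hs s)).choose)
      (fun s => (h₃.desc s.inl (hs s)).choose_spec) (fun s => ?_) (fun s u hu _ => ?_)⟩⟩
    · have e := (h₃.desc s.inl (hs s)).choose_spec
      rw [← cancel_epi l, reassoc_of% hi, e, s.condition]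
    · have e := (h₃.desc s.inl (hs s)).choose_spec
      rw [← cancel_epi q, hu, e]
  have hip : i ≫ p = 0 := by
    rw [← cancel_epi l, reassoc_of% hi, hp, h₂.zero]; simp
  have hpe : Epi p := by
    have : Epi (q ≫ p) := by rw [hp]; infer_instance
    exact epi_of_epi q p
  refine ⟨i, p, (h₂.inflation.of_isPushout hP).isConfl_of_cokernel hip hpe fun u hu => ?_, hp,
    hi.symm⟩
  obtain ⟨v, hv⟩ := h₂.desc (q ≫ u) (by rw [← reassoc_of% hi, hu]; simp)
  exact ⟨v, by rw [← cancel_epi q, reassoc_of% hp, hv]⟩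

end Conflations

section Counting

variable {C : Type*} [Category C] [Preadditive C] [HasZeroObject C] [HasBinaryBiproducts C]
  [ExactStructure C]

/-- Pairs of short exact sequences `B ⟶ X ⟶ A` and `D ⟶ Y ⟶ X`. -/
abbrev QuotFlag (A B D Y : C) : Type _ :=
  Σ x : IsoClass C, ShortExacts A B (rep x) × ShortExacts (rep x) D Y

/-- Pairs of short exact sequences `D ⟶ Z ⟶ B` and `Z ⟶ Y ⟶ A`. -/
abbrev SubFlag (A B D Y : C) : Type _ :=
  Σ z : IsoClass C, ShortExacts B D (rep z) × ShortExacts A (rep z) Y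

/-- The two flags fit into a commutative diagram. -/
def Compat {A B D Y : C} (s : QuotFlag A B D Y) (t : SubFlag A B D Y) : Prop :=
  s.2.2.1.2 ≫ s.2.1.1.2 = t.2.2.1.2 ∧ t.2.1.1.1 ≫ t.2.2.1.1 = s.2.2.1.1 ∧
    t.2.2.1.1 ≫ s.2.2.1.2 = t.2.1.1.2 ≫ s.2.1.1.1

lemma exists_equiv_compat_left {A B D Y : C} (s : QuotFlag A B D Y) :
    ∃ z : IsoClass C, (∀ t, Compat s t → t.1 = z) ∧
      Nonempty (Aut (rep z) ≃ {t : SubFlag A B D Y // Compat s t}) := by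
  obtain ⟨x, ⟨⟨i, p⟩, h₁⟩, ⟨⟨j, q⟩, h₂⟩⟩ := s
  change IsConfl i p at h₁
  change IsConfl j q at h₂
  obtain ⟨Z', m', hm'⟩ := IsDeflation.isConfl
    (ExactStructure.deflation_comp q p h₂.deflation h₁.deflation)
  obtain ⟨e⟩ := nonempty_iso_rep Z'
  obtain ⟨m, hm⟩ : ∃ m : rep (cls Z') ⟶ Y, IsConfl m (q ≫ p) :=
    ⟨e.hom ≫ m', hm'.of_iso e.symm (Iso.refl _) (Iso.refl _) (by simp) (by simp)⟩
  generalize cls Z' = z at m hm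
  obtain ⟨k, l, hkl, hkm, hml⟩ := exists_of_quot h₁ h₂ hm
  have := hm.mono
  have := h₁.mono
  refine ⟨z, ?_, ⟨Equiv.ofBijective (fun φ : rep z ≅ rep z => ⟨⟨z, ⟨(k ≫ φ.hom, φ.inv ≫ l), ?_⟩,
    ⟨(φ.inv ≫ m, q ≫ p), ?_⟩⟩, ?_⟩) ⟨?_, ?_⟩⟩⟩
  · rintro ⟨z', ⟨⟨k', l'⟩, h₃⟩, ⟨⟨m₁, n⟩, h₄⟩⟩ ⟨hc, -, -⟩
    change IsConfl m₁ n at h₄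
    obtain rfl : q ≫ p = n := hc
    exact eq_of_iso_rep (hm.kernel_iso h₄).choose
  · exact hkl.of_iso (Iso.refl _) φ (Iso.refl _) (by simp) (by simp)
  · exact hm.of_iso φ (Iso.refl _) (Iso.refl _) (by simp) (by simp)
  · exact ⟨rfl, by simp [hkm], by simp [hml]⟩
  · intro φ ψ h
    have h' : φ.inv ≫ m = ψ.inv ≫ m := by
      have := congrArg Subtype.val h
      simp only [Sigma.mk.injEq, heq_eq_eq, true_and, Prod.mk.injEq] at this
      exact congrArg (fun t => t.1.1) this.2
    rw [cancel_mono] at h'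
    exact Iso.ext ((Iso.inv_eq_inv _ _).1 h')
  · rintro ⟨⟨z', ⟨⟨k', l'⟩, h₃⟩, ⟨⟨m₁, n⟩, h₄⟩⟩, hc, hk', hl'⟩
    change IsConfl m₁ n at h₄
    change IsConfl k' l' at h₃
    obtain rfl : q ≫ p = n := hc
    obtain ⟨f, hf⟩ := hm.kernel_iso h₄
    obtain rfl := eq_of_iso_rep f
    have := h₄.mono
    have e₁ : f.inv ≫ m₁ = m := by rw [← hf]; simp
    change k' ≫ m₁ = j at hk'
    change m₁ ≫ q = l' ≫ i at hl'
    refine ⟨f.symm, ?_⟩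
    have a₁ : k ≫ f.inv = k' := by
      rw [← cancel_mono m₁, Category.assoc, e₁, hkm, hk']
    have a₂ : f.hom ≫ l = l' := by
      rw [← cancel_mono i, Category.assoc, ← hml, ← hl', reassoc_of% hf]
    subst a₁ a₂ hf
    rfl

lemma exists_equiv_compat_right {A B D Y : C} (t : SubFlag A B D Y) :
    ∃ x : IsoClass C, (∀ s, Compat s t → s.1 = x) ∧
      Nonempty (Aut (rep x) ≃ {s : QuotFlag A B D Y // Compat s t}) := by
  obtain ⟨z, ⟨⟨k, l⟩, h₁⟩, ⟨⟨m, n⟩, h₂⟩⟩ := t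
  change IsConfl k l at h₁
  change IsConfl m n at h₂
  obtain ⟨X', q', hq'⟩ := IsInflation.isConfl
    (ExactStructure.inflation_comp k m h₁.inflation h₂.inflation)
  obtain ⟨e⟩ := nonempty_iso_rep X'
  obtain ⟨q, hq⟩ : ∃ q : Y ⟶ rep (cls X'), IsConfl (k ≫ m) q :=
    ⟨q' ≫ e.inv, hq'.of_iso (Iso.refl _) (Iso.refl _) e.symm (by simp) (by simp)⟩
  generalize cls X' = x at q hq
  obtain ⟨i, p, hip, hqp, hml⟩ := exists_of_sub h₁ h₂ hq
  have := hq.epi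
  have := h₁.epi
  refine ⟨x, ?_, ⟨Equiv.ofBijective (fun φ : rep x ≅ rep x => ⟨⟨x, ⟨(i ≫ φ.hom, φ.inv ≫ p), ?_⟩,
    ⟨(k ≫ m, q ≫ φ.hom), ?_⟩⟩, ?_⟩) ⟨?_, ?_⟩⟩⟩
  · rintro ⟨x', ⟨⟨i', p'⟩, h₃⟩, ⟨⟨j, q₁⟩, h₄⟩⟩ ⟨-, hc, -⟩
    change IsConfl j q₁ at h₄
    obtain rfl : k ≫ m = j := hc
    exact eq_of_iso_rep (h₄.cokernel_iso hq).choose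
  · exact hip.of_iso (Iso.refl _) φ (Iso.refl _) (by simp) (by simp)
  · exact hq.of_iso (Iso.refl _) (Iso.refl _) φ (by simp) (by simp)
  · exact ⟨by simp [hqp], rfl, by simp [reassoc_of% hml]⟩
  · intro φ ψ h
    have h' : q ≫ φ.hom = q ≫ ψ.hom := by
      have := congrArg Subtype.val h
      simp only [Sigma.mk.injEq, heq_eq_eq, true_and, Prod.mk.injEq] at this
      exact congrArg (fun t => t.1.2) this.2
    rw [cancel_epi] at h'
    exact Iso.ext h'
  · rintro ⟨⟨x', ⟨⟨i', p'⟩, h₃⟩, ⟨⟨j, q₁⟩, h₄⟩⟩, hp', hc, hl'⟩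
    change IsConfl j q₁ at h₄
    change IsConfl i' p' at h₃
    obtain rfl : k ≫ m = j := hc
    obtain ⟨f, hf⟩ := hq.cokernel_iso h₄
    obtain rfl := eq_of_iso_rep f
    have := h₄.epi
    change q₁ ≫ p' = n at hp'
    change m ≫ q₁ = l ≫ i' at hl'
    refine ⟨f, ?_⟩
    have a₁ : i ≫ f.hom = i' := by
      rw [← cancel_epi l, ← hl', ← hf, reassoc_of% hml]
    have a₂ : f.inv ≫ p = p' := by
      rw [← cancel_epi q₁, hp', ← hf, ← hqp]; simp
    subst a₁ a₂ hf
    rfl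

lemma finite_quot [HomFinite C] (D Y : C) :
    {x : IsoClass C | (ShortExacts (rep x) D Y).Nonempty}.Finite := by
  classical
  refine Set.Finite.of_finite_image (f := fun x => if h : (ShortExacts (rep x) D Y).Nonempty
    then h.some.1 else 0) (Set.toFinite _) ?_
  intro x hx y hy h
  change Set.Nonempty _ at hx hy
  simp only [hx, hy, dif_pos] at h
  have h₁ : IsConfl hx.some.1 hx.some.2 := hx.some_mem
  have h₂ : IsConfl hx.some.1 hy.some.2 := by rw [h]; exact hy.some_mem
  exact eq_of_iso_rep (h₁.cokernel_iso h₂).choose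

lemma finite_sub [HomFinite C] (A Y : C) :
    {x : IsoClass C | (ShortExacts A (rep x) Y).Nonempty}.Finite := by
  classical
  refine Set.Finite.of_finite_image (f := fun x => if h : (ShortExacts A (rep x) Y).Nonempty
    then h.some.2 else 0) (Set.toFinite _) ?_
  intro x hx y hy h
  change Set.Nonempty _ at hx hy
  simp only [hx, hy, dif_pos] at h
  have h₁ : IsConfl hx.some.1 hx.some.2 := hx.some_mem
  have h₂ : IsConfl hy.some.1 hx.some.2 := by rw [h]; exact hy.some_mem
  exact eq_of_iso_rep (h₂.kernel_iso h₁).choose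

instance [HomFinite C] (A B X : C) : Finite (ShortExacts A B X) := Subtype.finite

instance {C : Type*} [Category C] [HomFinite C] (X : C) : Finite (Aut X) :=
  Finite.of_injective (fun φ : Aut X => φ.hom) fun _ _ h => Iso.ext h

lemma finite_sigma_of_finite {ι : Type*} {F : ι → Type*} [∀ i, Finite (F i)]
    (h : {i | Nonempty (F i)}.Finite) : Finite (Σ i, F i) := by
  have := h.to_subtype
  exact Finite.of_injective
    (fun s : Σ i, F i => (⟨⟨s.1, ⟨s.2⟩⟩, s.2⟩ : Σ i : {i | Nonempty (F i)}, F i))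
    (by rintro ⟨i, a⟩ ⟨j, b⟩ h; simp only [Sigma.mk.injEq, Subtype.mk.injEq] at h; aesop)

instance [HomFinite C] (A B D Y : C) : Finite (QuotFlag A B D Y) :=
  finite_sigma_of_finite ((finite_quot D Y).subset fun _ ⟨_, t⟩ => ⟨t.1, t.2⟩)

instance [HomFinite C] (A B D Y : C) : Finite (SubFlag A B D Y) :=
  finite_sigma_of_finite ((finite_sub A Y).subset fun _ ⟨_, t⟩ => ⟨t.1, t.2⟩)

/-- The number of automorphisms of an object. -/
noncomputable def autCard {C : Type*} [Category C] (X : C) : ℚ := Nat.card (Aut X)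

lemma autCard_ne_zero {C : Type*} [Category C] [HomFinite C] (X : C) : autCard X ≠ 0 := by
  have : Nat.card (Aut X) ≠ 0 := Nat.card_ne_zero.2 ⟨⟨Iso.refl X⟩, inferInstance⟩
  simpa [autCard] using this

lemma sum_sigma_eq_finsum {ι : Type*} {F : ι → Type*} [∀ i, Finite (F i)] [Fintype (Σ i, F i)]
    (w : ι → ℚ) : ∑ s : (Σ i, F i), w s.1 = ∑ᶠ i, (Nat.card (F i) : ℚ) * w i := by
  classical
  have (i : ι) := Fintype.ofFinite (F i)
  let S : Finset ι := Finset.univ.image (fun s : Σ i, F i => s.1)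
  have hS : ∀ i, F i → i ∈ S := fun i a => Finset.mem_image.2 ⟨⟨i, a⟩, by simp⟩
  rw [finsum_eq_sum_of_support_subset (s := S)]
  · rw [show (Finset.univ : Finset (Σ i, F i)) = S.sigma fun _ => Finset.univ by
      ext ⟨i, a⟩; simpa using hS i a, Finset.sum_sigma]
    simp
  · intro i hi
    have : Nat.card (F i) ≠ 0 := fun h => hi (by beta_reduce; rw [h]; simp)
    exact hS i (Nat.card_ne_zero.1 this).1.some

lemma sum_indicator_aux {C : Type*} [Category C] {T : Type*} [Fintype T] {c : T → Prop} [DecidablePred c] {w : T → ℚ}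
    {z : C} (hz : autCard z ≠ 0) (h : ∀ t, c t → w t = (autCard z)⁻¹)
    (e : Nonempty (Aut z ≃ {t // c t})) : ∑ t, (if c t then w t else 0) = 1 := by
  rw [← Finset.sum_filter, Finset.sum_congr rfl (fun t ht => h t (Finset.mem_filter.1 ht).2),
    Finset.sum_const, ← Fintype.card_subtype, nsmul_eq_mul, ← Nat.card_eq_fintype_card,
    ← Nat.card_congr e.some]
  exact mul_inv_cancel₀ hz

/-- The count of flags behind the associativity of the Hall product. -/
lemma finsum_flags [HomFinite C] (A B D Y : C) :
    ∑ᶠ x : IsoClass C, (Nat.card (ShortExacts A B (rep x)) * Nat.card (ShortExacts (rep x) D Y) : ℚ)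
        * (autCard (rep x))⁻¹ =
      ∑ᶠ z : IsoClass C, (Nat.card (ShortExacts B D (rep z)) * Nat.card (ShortExacts A (rep z) Y) : ℚ)
        * (autCard (rep z))⁻¹ := by
  classical
  have := Fintype.ofFinite (QuotFlag A B D Y)
  have := Fintype.ofFinite (SubFlag A B D Y)
  have h₁ := sum_sigma_eq_finsum
    (F := fun x : IsoClass C => ShortExacts A B (rep x) × ShortExacts (rep x) D Y)
    (fun x => (autCard (rep x))⁻¹)
  have h₂ := sum_sigma_eq_finsum
    (F := fun x : IsoClass C => ShortExacts B D (rep x) × ShortExacts A (rep x) Y)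
    (fun x => (autCard (rep x))⁻¹)
  simp only [Nat.card_prod, Nat.cast_mul] at h₁ h₂
  rw [← h₁, ← h₂]
  calc ∑ s : QuotFlag A B D Y, (autCard (rep s.1))⁻¹
      = ∑ s : QuotFlag A B D Y, ∑ t : SubFlag A B D Y,
          (if Compat s t then (autCard (rep s.1))⁻¹ * (autCard (rep t.1))⁻¹ else 0) := by
        refine Finset.sum_congr rfl fun s _ => ?_
        obtain ⟨z, hz, e⟩ := exists_equiv_compat_left s
        have := sum_indicator_aux (c := Compat s) (w := fun t => (autCard (rep t.1))⁻¹)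
          (autCard_ne_zero (rep z)) (fun t ht => by rw [hz t ht]) e
        calc _ = (autCard (rep s.1))⁻¹ * 1 := (mul_one _).symm
          _ = _ := by rw [← this, Finset.mul_sum]; simp [mul_ite]
    _ = ∑ t : SubFlag A B D Y, ∑ s : QuotFlag A B D Y,
          (if Compat s t then (autCard (rep s.1))⁻¹ * (autCard (rep t.1))⁻¹ else 0) :=
        Finset.sum_comm
    _ = ∑ t : SubFlag A B D Y, (autCard (rep t.1))⁻¹ := by
        refine Finset.sum_congr rfl fun t _ => ?_
        obtain ⟨x, hx, e⟩ := exists_equiv_compat_right t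
        have := sum_indicator_aux (c := fun s => Compat s t) (w := fun s => (autCard (rep s.1))⁻¹)
          (autCard_ne_zero (rep x)) (fun s hs => by rw [hx s hs]) e
        calc _ = 1 * (autCard (rep t.1))⁻¹ := by rw [← this, Finset.sum_mul]; simp [ite_mul]
          _ = _ := one_mul _

end Counting

section HallNumbers

variable {C : Type*} [Category C] [Preadditive C] [HasZeroObject C] [HasBinaryBiproducts C]
  [ExactStructure C]

/-- The Hall number `F_{A,B}^X`, that is the number of orbits of the free action of
`Aut A × Aut B` on the set of short exact sequences `B ⟶ X ⟶ A`. -/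
noncomputable def hallNumber (A B X : C) : ℚ :=
  Nat.card (ShortExacts A B X) / (autCard A * autCard B)

/-- The dual Hall number `F^{A,B}_X`. -/
noncomputable def dualHallNumber (A B X : C) : ℚ :=
  autCard A * autCard B / autCard X * hallNumber B A X

/-- The Hall number of three isomorphism classes. It does not depend on the representatives. -/
noncomputable def hallNum (a b x : IsoClass C) : ℚ := hallNumber (rep a) (rep b) (rep x)

/-- The dual Hall number of three isomorphism classes. -/
noncomputable def dualHallNum (a b x : IsoClass C) : ℚ := dualHallNumber (rep a) (rep b) (rep x)

lemma ShortExacts.card_congr {A B X A' B' X' : C} (a : A ≅ A') (b : B ≅ B') (x : X ≅ X') :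
    Nat.card (ShortExacts A B X) = Nat.card (ShortExacts A' B' X') := by
  refine Nat.card_congr ⟨fun p => ⟨(b.inv ≫ p.1.1 ≫ x.hom, x.inv ≫ p.1.2 ≫ a.hom), ?_⟩,
    fun p => ⟨(b.hom ≫ p.1.1 ≫ x.inv, x.hom ≫ p.1.2 ≫ a.inv), ?_⟩, ?_, ?_⟩
  · exact IsConfl.of_iso p.2 b x a (by simp) (by simp)
  · exact IsConfl.of_iso p.2 b.symm x.symm a.symm (by simp) (by simp)
  · intro p; ext <;> simp
  · intro p; ext <;> simp

lemma autCard_congr {C : Type*} [Category C] {A A' : C} (a : A ≅ A') : autCard A = autCard A' := by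
  unfold autCard
  rw [Nat.card_congr (Aut.autMulEquivOfIso a).toEquiv]

lemma hallNum_cls (A B X : C) : hallNum (cls A) (cls B) (cls X) = hallNumber A B X := by
  obtain ⟨a⟩ := nonempty_iso_rep A
  obtain ⟨b⟩ := nonempty_iso_rep B
  obtain ⟨x⟩ := nonempty_iso_rep X
  simp only [hallNum, hallNumber, autCard_congr a, autCard_congr b,
    ShortExacts.card_congr a b x]

lemma dualHallNum_cls (A B X : C) :
    dualHallNum (cls A) (cls B) (cls X) = dualHallNumber A B X := by
  obtain ⟨a⟩ := nonempty_iso_rep A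
  obtain ⟨b⟩ := nonempty_iso_rep B
  obtain ⟨x⟩ := nonempty_iso_rep X
  simp only [dualHallNum, dualHallNumber, hallNumber, autCard_congr a, autCard_congr b,
    autCard_congr x, ShortExacts.card_congr b a x]

lemma nonempty_of_hallNum_ne_zero {a b x : IsoClass C} (h : hallNum a b x ≠ 0) :
    (ShortExacts (rep a) (rep b) (rep x)).Nonempty := by
  by_contra h'
  rw [Set.not_nonempty_iff_eq_empty] at h'
  simp [hallNum, hallNumber, h'] at h

lemma hallNum_assoc [HomFinite C] (a b d y : IsoClass C) :
    ∑ᶠ x, hallNum a b x * hallNum x d y = ∑ᶠ z, hallNum b d z * hallNum a z y := by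
  have h := congrArg (fun r => (autCard (rep a) * autCard (rep b) * autCard (rep d))⁻¹ * r)
    (finsum_flags (rep a) (rep b) (rep d) (rep y))
  beta_reduce at h
  rw [mul_finsum, mul_finsum] at h
  refine (finsum_congr fun x => ?_).trans (h.trans (finsum_congr fun x => ?_))
  · simp only [hallNum, hallNumber, div_eq_mul_inv, mul_inv]; ring
  · simp only [hallNum, hallNumber, div_eq_mul_inv, mul_inv]; ring

lemma dualHallNum_coassoc [HomFinite C] (a b d y : IsoClass C) :
    ∑ᶠ x, dualHallNum x d y * dualHallNum a b x =
      ∑ᶠ z, dualHallNum a z y * dualHallNum b d z := by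
  have h := congrArg
    (fun r => (autCard (rep a) * autCard (rep b) * autCard (rep d) / autCard (rep y)) * r)
    (hallNum_assoc d b a y).symm
  beta_reduce at h
  rw [mul_finsum, mul_finsum] at h
  refine (finsum_congr fun x => ?_).trans (h.trans (finsum_congr fun x => ?_))
  · have := autCard_ne_zero (rep x)
    have := autCard_ne_zero (rep y)
    simp only [hallNum, dualHallNum, dualHallNumber]; field_simp
  · have := autCard_ne_zero (rep x)
    have := autCard_ne_zero (rep y)
    simp only [hallNum, dualHallNum, dualHallNumber]; field_simp

lemma isConfl_zero_right {B X Z : C} (e : B ≅ X) (hZ : IsZero Z) :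
    IsConfl e.hom (0 : X ⟶ Z) := by
  obtain ⟨W, g, h⟩ := IsInflation.isConfl (ExactStructure.inflation_id B)
  have := h.epi
  have hg : g = 0 := by simpa using h.zero
  have hW : IsZero W := IsZero.of_epi_eq_zero g hg
  exact h.of_iso (Iso.refl _) e (hW.iso hZ) (by simp) (by simp [hg])

lemma isConfl_zero_left {A X Z : C} (e : X ≅ A) (hZ : IsZero Z) :
    IsConfl (0 : Z ⟶ X) e.hom := by
  obtain ⟨W, g, h⟩ := IsDeflation.isConfl (ExactStructure.deflation_id X)
  have := h.mono
  have hg : g = 0 := by simpa using h.zero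
  have hW : IsZero W := IsZero.of_mono_eq_zero g hg
  exact h.of_iso (hW.iso hZ) (Iso.refl _) e (by simp [hg]) (by simp)

lemma card_zero_left {B X Z : C} (hZ : IsZero Z) :
    Nat.card (ShortExacts Z B X) = Nat.card (B ≅ X) := by
  refine (Nat.card_congr (Equiv.ofBijective
    (fun e : B ≅ X => (⟨(e.hom, 0), isConfl_zero_right e hZ⟩ : ShortExacts Z B X)) ⟨?_, ?_⟩)).symm
  · intro e e' h
    exact Iso.ext (congrArg (fun t => t.1.1) h)
  · rintro ⟨⟨f, g⟩, h⟩
    change IsConfl f g at h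
    obtain rfl : g = 0 := hZ.eq_of_tgt _ _
    have := h.mono
    obtain ⟨v, hv⟩ := h.lift (𝟙 X) (by simp)
    exact ⟨⟨f, v, by rw [← cancel_mono f]; simp [hv], hv⟩, rfl⟩

lemma card_zero_right {A X Z : C} (hZ : IsZero Z) :
    Nat.card (ShortExacts A Z X) = Nat.card (X ≅ A) := by
  refine (Nat.card_congr (Equiv.ofBijective
    (fun e : X ≅ A => (⟨(0, e.hom), isConfl_zero_left e hZ⟩ : ShortExacts A Z X)) ⟨?_, ?_⟩)).symm
  · intro e e' h
    exact Iso.ext (congrArg (fun t => t.1.2) h)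
  · rintro ⟨⟨f, g⟩, h⟩
    change IsConfl f g at h
    obtain rfl : f = 0 := hZ.eq_of_src _ _
    have := h.epi
    obtain ⟨v, hv⟩ := h.desc (𝟙 X) (by simp)
    exact ⟨⟨g, v, hv, by rw [← cancel_epi g, reassoc_of% hv]; simp⟩, rfl⟩

open scoped ZeroObject in
/-- The isomorphism class of the zero object. -/
noncomputable def zeroCls (C : Type*) [Category C] [HasZeroObject C] : IsoClass C := cls (0 : C)

open scoped ZeroObject in
lemma isZero_rep_zeroCls {C : Type*} [Category C] [HasZeroObject C] : IsZero (rep (zeroCls C)) :=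
  (isZero_zero C).of_iso (nonempty_iso_rep (0 : C)).some

lemma autCard_of_isZero {C : Type*} [Category C] {Z : C} (hZ : IsZero Z) : autCard Z = 1 := by
  have : Unique (Aut Z) := ⟨⟨Iso.refl Z⟩, fun e => Iso.ext (hZ.eq_of_src _ _)⟩
  simp [autCard]

lemma card_iso_rep {C : Type*} [Category C] (b x : IsoClass C) [Decidable (b = x)] :
    (Nat.card (rep b ≅ rep x) : ℚ) = if b = x then autCard (rep b) else 0 := by
  split_ifs with h
  · subst h; rfl
  · have : IsEmpty (rep b ≅ rep x) := ⟨fun e => h (eq_of_iso_rep e)⟩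
    simp

lemma hallNum_zero_left [HomFinite C] (b x : IsoClass C) [Decidable (b = x)] :
    hallNum (zeroCls C) b x = if b = x then 1 else 0 := by
  have := autCard_ne_zero (rep b)
  rw [hallNum, hallNumber, card_zero_left isZero_rep_zeroCls, card_iso_rep,
    autCard_of_isZero isZero_rep_zeroCls]
  split_ifs <;> simp [this]

lemma hallNum_zero_right [HomFinite C] (a x : IsoClass C) [Decidable (a = x)] :
    hallNum a (zeroCls C) x = if a = x then 1 else 0 := by
  classical
  have := autCard_ne_zero (rep a)
  rw [hallNum, hallNumber, card_zero_right isZero_rep_zeroCls, card_iso_rep,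
    autCard_of_isZero isZero_rep_zeroCls]
  by_cases h : a = x
  · subst h; simp [this]
  · simp [h, Ne.symm h]

lemma dualHallNum_zero_left [HomFinite C] (b x : IsoClass C) [Decidable (b = x)] :
    dualHallNum (zeroCls C) b x = if b = x then 1 else 0 := by
  have := autCard_ne_zero (rep x)
  change _ * hallNum b (zeroCls C) x = _
  rw [hallNum_zero_right, autCard_of_isZero isZero_rep_zeroCls]
  split_ifs with h
  · subst h; simp [this]
  · simp

lemma dualHallNum_zero_right [HomFinite C] (a x : IsoClass C) [Decidable (a = x)] :
    dualHallNum a (zeroCls C) x = if a = x then 1 else 0 := by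
  have := autCard_ne_zero (rep x)
  change _ * hallNum (zeroCls C) a x = _
  rw [hallNum_zero_left, autCard_of_isZero isZero_rep_zeroCls]
  split_ifs with h
  · subst h; simp [this]
  · simp

lemma finite_support_hallNum [Finitary C] (a b : IsoClass C) :
    (Function.support (hallNum a b)).Finite :=
  (Finitary.finite_ext (rep a) (rep b)).subset fun x hx =>
    ⟨rep x, cls_rep x, nonempty_of_hallNum_ne_zero hx⟩

lemma finite_support_dualHallNum [Cofinitary C] (x : IsoClass C) :
    (Function.support fun p : IsoClass C × IsoClass C => dualHallNum p.1 p.2 x).Finite := by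
  refine ((Cofinitary.finite_coext (rep x)).preimage
    (Prod.swap_injective.injOn (s := Set.univ) |>.mono (Set.subset_univ _))).subset fun p hp => ?_
  have h : hallNum p.2 p.1 x ≠ 0 := fun h => hp (by
    change _ * hallNum p.2 p.1 x = 0
    rw [h, mul_zero])
  exact ⟨rep p.2, rep p.1, by simp [Prod.swap], rep x, rfl, nonempty_of_hallNum_ne_zero h⟩

end HallNumbers

section HallAlgebra

/-- The underlying space of the Hall algebra: the rational vector space with basis the set of
isomorphism classes. -/
def HallAlgebra (C : Type*) [Category C] : Type _ := IsoClass C →₀ ℚ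

namespace HallAlgebra

noncomputable instance (C : Type*) [Category C] : AddCommGroup (HallAlgebra C) :=
  inferInstanceAs (AddCommGroup (IsoClass C →₀ ℚ))

noncomputable instance (C : Type*) [Category C] : Module ℚ (HallAlgebra C) :=
  inferInstanceAs (Module ℚ (IsoClass C →₀ ℚ))

/-- The identification of the Hall algebra with the space of finitely supported functions. -/
noncomputable def equiv (C : Type*) [Category C] : HallAlgebra C ≃ₗ[ℚ] (IsoClass C →₀ ℚ) :=
  LinearEquiv.refl ℚ _

/-- The basis vector of an isomorphism class. -/
noncomputable def of {C : Type*} [Category C] (x : IsoClass C) : HallAlgebra C :=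
  (equiv C).symm (Finsupp.single x 1)

/-- The linear map with prescribed values on the basis of isomorphism classes. -/
noncomputable def lift {C : Type*} [Category C] {M : Type*} [AddCommGroup M] [Module ℚ M]
    (v : IsoClass C → M) : HallAlgebra C →ₗ[ℚ] M :=
  Finsupp.linearCombination ℚ v ∘ₗ (equiv C).toLinearMap

/-- The coefficient of an element at an isomorphism class. -/
noncomputable def coeff {C : Type*} [Category C] (x : IsoClass C) : HallAlgebra C →ₗ[ℚ] ℚ :=
  Finsupp.lapply x ∘ₗ (equiv C).toLinearMap

section Basic

variable {C : Type*} [Category C]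

@[simp] lemma lift_of {M : Type*} [AddCommGroup M] [Module ℚ M] (v : IsoClass C → M)
    (x : IsoClass C) : lift v (of x) = v x := by
  simp [lift, of]

lemma coeff_of [DecidableEq (IsoClass C)] (x y : IsoClass C) :
    coeff y (of x) = if x = y then 1 else 0 := by
  simp [coeff, of, Finsupp.single_apply]

lemma ext {u v : HallAlgebra C} (h : ∀ x, coeff x u = coeff x v) : u = v :=
  (equiv C).injective (Finsupp.ext h)

lemma hom_ext {M : Type*} [AddCommGroup M] [Module ℚ M] {f g : HallAlgebra C →ₗ[ℚ] M}
    (h : ∀ x, f (of x) = g (of x)) : f = g := by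
  have : f ∘ₗ (equiv C).symm.toLinearMap = g ∘ₗ (equiv C).symm.toLinearMap :=
    Finsupp.lhom_ext' fun x => LinearMap.ext_ring (h x)
  ext u
  simpa using congrArg (fun k => k (equiv C u)) this

lemma lift_eq_finsum_mul (w : IsoClass C → ℚ) (u : HallAlgebra C) :
    lift w u = ∑ᶠ x, coeff x u * w x := by
  simp only [lift, coeff, LinearMap.comp_apply, LinearEquiv.coe_coe, Finsupp.lapply_apply]
  rw [Finsupp.linearCombination_apply, Finsupp.sum,
    finsum_eq_sum_of_support_subset (s := (equiv C u).support)]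
  · rfl
  · intro x hx
    simp only [Finset.mem_coe, Finsupp.mem_support_iff]
    exact left_ne_zero_of_mul hx

end Basic

variable {C : Type*} [Category C] [Preadditive C] [HasZeroObject C] [HasBinaryBiproducts C]
  [ExactStructure C]

section Product

variable [Finitary C]

/-- The product of two isomorphism classes: `[A][B] = ∑ F_{A,B}^X [X]`. -/
noncomputable def basisMul (a b : IsoClass C) : HallAlgebra C :=
  (equiv C).symm (Finsupp.ofSupportFinite (hallNum a b) (finite_support_hallNum a b))

@[simp] lemma coeff_basisMul (a b x : IsoClass C) : coeff x (basisMul a b) = hallNum a b x := rfl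

/-- The bilinear Hall product. -/
noncomputable def mulHom : HallAlgebra C →ₗ[ℚ] HallAlgebra C →ₗ[ℚ] HallAlgebra C :=
  lift fun a => lift fun b => basisMul a b

lemma mulHom_of_of (a b : IsoClass C) : mulHom (of a) (of b) = basisMul a b := by
  simp [mulHom]

lemma coeff_mulHom_of_right (u : HallAlgebra C) (d y : IsoClass C) :
    coeff y (mulHom u (of d)) = ∑ᶠ x, coeff x u * hallNum x d y := by
  rw [← lift_eq_finsum_mul]
  have : (coeff y) ∘ₗ mulHom.flip (of d) = lift fun x => hallNum x d y :=
    hom_ext fun x => by simp [mulHom_of_of]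
  exact congrArg (fun f => f u) this

lemma coeff_mulHom_of_left (u : HallAlgebra C) (a y : IsoClass C) :
    coeff y (mulHom (of a) u) = ∑ᶠ x, coeff x u * hallNum a x y := by
  rw [← lift_eq_finsum_mul]
  have : (coeff y) ∘ₗ mulHom (of a) = lift fun x => hallNum a x y :=
    hom_ext fun x => by simp [mulHom_of_of]
  exact congrArg (fun f => f u) this

lemma mulHom_assoc_of (a b d : IsoClass C) :
    mulHom (mulHom (of a) (of b)) (of d) = mulHom (of a) (mulHom (of b) (of d)) := by
  refine ext fun y => ?_
  rw [coeff_mulHom_of_right, coeff_mulHom_of_left, mulHom_of_of, mulHom_of_of]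
  exact hallNum_assoc a b d y

lemma mulHom_assoc (u v w : HallAlgebra C) :
    mulHom (mulHom u v) w = mulHom u (mulHom v w) := by
  have h₁ : ∀ a b w, mulHom (mulHom (of a) (of b)) w = mulHom (C := C) (of a) (mulHom (of b) w) :=
    fun a b w => congrArg (fun f => f w) (hom_ext (f := mulHom (mulHom (of a) (of b)))
      (g := mulHom (of a) ∘ₗ mulHom (C := C) (of b)) fun d => mulHom_assoc_of a b d)
  have h₂ : ∀ a v w, mulHom (mulHom (of a) v) w = mulHom (C := C) (of a) (mulHom v w) :=
    fun a v w => congrArg (fun f => f v) (hom_ext (f := mulHom.flip w ∘ₗ mulHom (of a))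
      (g := mulHom (of a) ∘ₗ mulHom.flip w) fun b => h₁ a b w)
  exact congrArg (fun f => f u) (hom_ext (f := mulHom.flip w ∘ₗ mulHom.flip v)
      (g := mulHom.flip (mulHom v w)) fun a => h₂ a v w)

noncomputable instance : Mul (HallAlgebra C) := ⟨fun u v => mulHom u v⟩

noncomputable instance (C : Type*) [Category C] [HasZeroObject C] : One (HallAlgebra C) :=
  ⟨of (zeroCls C)⟩

lemma mul_def (u v : HallAlgebra C) : u * v = mulHom u v := rfl

lemma one_def (C : Type*) [Category C] [HasZeroObject C] : (1 : HallAlgebra C) = of (zeroCls C) := rfl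

/-- The Hall algebra of a finitary exact category, as a ring. -/
noncomputable instance : Ring (HallAlgebra C) :=
  { (inferInstance : AddCommGroup (HallAlgebra C)) with
    mul := (· * ·)
    one := 1
    mul_assoc := mulHom_assoc
    one_mul := fun u => by
      have : mulHom (of (zeroCls C)) = LinearMap.id := hom_ext fun b => by
        classical
        refine ext fun x => ?_
        simp [mulHom_of_of, hallNum_zero_left, coeff_of]
      exact congrArg (fun f => f u) this
    mul_one := fun u => by
      have : mulHom.flip (of (zeroCls C)) = LinearMap.id := hom_ext fun b => by
        classical
        refine ext fun x => ?_
        simp [mulHom_of_of, hallNum_zero_right, coeff_of]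
      exact congrArg (fun f => f u) this
    left_distrib := fun u v w => map_add (mulHom u) v w
    right_distrib := fun u v w => by simp [mul_def]
    zero_mul := fun u => by simp [mul_def]
    mul_zero := fun u => by simp [mul_def] }

noncomputable instance : Algebra ℚ (HallAlgebra C) :=
  Algebra.ofModule (fun r u v => by simp [mul_def]) (fun r u v => by simp [mul_def])

end Product

section Coproduct

variable [Cofinitary C]

/-- The coefficients of the coproduct of an isomorphism class. -/
noncomputable def comulCoeff (x : IsoClass C) : IsoClass C × IsoClass C →₀ ℚ :=
  Finsupp.ofSupportFinite (fun p => dualHallNum p.1 p.2 x) (finite_support_dualHallNum x)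

/-- The coproduct of an isomorphism class: `Δ[X] = ∑ F^{A,B}_X [A] ⊗ [B]`. -/
noncomputable def basisComul (x : IsoClass C) : HallAlgebra C ⊗[ℚ] HallAlgebra C :=
  (comulCoeff x).sum fun p r => r • (of p.1 ⊗ₜ[ℚ] of p.2)

open scoped Classical in
noncomputable instance : CoalgebraStruct ℚ (HallAlgebra C) where
  comul := lift basisComul
  counit := lift fun x => if x = zeroCls C then 1 else 0

lemma comul_of (x : IsoClass C) :
    CoalgebraStruct.comul (R := ℚ) (of x) = basisComul x := lift_of _ _

open scoped Classical in
lemma counit_of (x : IsoClass C) :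
    CoalgebraStruct.counit (R := ℚ) (of x) = if x = zeroCls C then 1 else 0 := lift_of _ _

/-- Coordinates on the tensor square. -/
noncomputable def equiv₂ (C : Type*) [Category C] :
    HallAlgebra C ⊗[ℚ] HallAlgebra C ≃ₗ[ℚ] (IsoClass C × IsoClass C →₀ ℚ) :=
  TensorProduct.congr (equiv C) (equiv C) ≪≫ₗ finsuppTensorFinsupp' ℚ _ _

/-- Coordinates on the tensor cube. -/
noncomputable def equiv₃ (C : Type*) [Category C] :
    HallAlgebra C ⊗[ℚ] (HallAlgebra C ⊗[ℚ] HallAlgebra C) ≃ₗ[ℚ]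
      (IsoClass C × (IsoClass C × IsoClass C) →₀ ℚ) :=
  TensorProduct.congr (equiv C) (equiv₂ C) ≪≫ₗ finsuppTensorFinsupp' ℚ _ _

lemma equiv₂_tmul {C : Type*} [Category C] (u v : HallAlgebra C) (a b : IsoClass C) :
    equiv₂ C (u ⊗ₜ v) (a, b) = coeff a u * coeff b v := by
  simp [equiv₂, coeff]

lemma equiv₃_tmul {C : Type*} [Category C] (u : HallAlgebra C) (t : HallAlgebra C ⊗[ℚ] HallAlgebra C) (a b c : IsoClass C) :
    equiv₃ C (u ⊗ₜ t) (a, (b, c)) = coeff a u * equiv₂ C t (b, c) := by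
  simp [equiv₃, coeff]

lemma equiv₃_assoc_tmul {C : Type*} [Category C] (t : HallAlgebra C ⊗[ℚ] HallAlgebra C) (u : HallAlgebra C)
    (a b c : IsoClass C) :
    equiv₃ C (TensorProduct.assoc ℚ _ _ _ (t ⊗ₜ u)) (a, (b, c)) =
      equiv₂ C t (a, b) * coeff c u := by
  induction t with
  | zero => simp
  | add s t hs ht => simp only [TensorProduct.add_tmul, map_add, Finsupp.add_apply, hs, ht, add_mul]
  | tmul v w =>
    rw [TensorProduct.assoc_tmul, equiv₃_tmul, equiv₂_tmul, equiv₂_tmul, mul_assoc]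

lemma equiv₂_basisComul (x a b : IsoClass C) :
    equiv₂ C (basisComul x) (a, b) = dualHallNum a b x := by
  have : equiv₂ C (basisComul x) = comulCoeff x := by
    rw [basisComul, map_finsuppSum]
    conv_rhs => rw [← Finsupp.sum_single (comulCoeff x)]
    refine Finsupp.sum_congr fun p _ => ?_
    simp [equiv₂, of]
  rw [this]; rfl

lemma sum_comulCoeff_fst (x c : IsoClass C) [DecidableEq (IsoClass C)] (g : IsoClass C → ℚ) :
    (comulCoeff x).sum (fun p r => r * (g p.1 * if p.2 = c then 1 else 0)) =
      ∑ᶠ z, dualHallNum z c x * g z := by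
  rw [Finsupp.sum, finsum_eq_sum_of_support_subset (s := (comulCoeff x).support.image Prod.fst)]
  · simp only [mul_ite, mul_one, mul_zero]
    rw [← Finset.sum_filter]
    refine Finset.sum_of_injOn Prod.fst ?_ ?_ ?_ ?_
    · rintro ⟨p, q⟩ hp ⟨p', q'⟩ hq h
      simp only [Finset.coe_filter, Set.mem_ofPred_eq] at hp hq
      exact Prod.ext h (hp.2.trans hq.2.symm)
    · intro p hp
      exact Finset.mem_image_of_mem _ (Finset.mem_filter.1 hp).1
    · intro z _ hz
      by_contra h
      refine hz ⟨(z, c), Finset.mem_filter.2 ⟨?_, rfl⟩, rfl⟩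
      exact Finsupp.mem_support_iff.2 (left_ne_zero_of_mul h)
    · rintro ⟨p, q⟩ hp
      obtain rfl : q = c := (Finset.mem_filter.1 hp).2
      rfl
  · intro z hz
    exact Finset.mem_image.2 ⟨(z, c), Finsupp.mem_support_iff.2 (left_ne_zero_of_mul hz), rfl⟩

lemma sum_comulCoeff_snd (x c : IsoClass C) [DecidableEq (IsoClass C)] (g : IsoClass C → ℚ) :
    (comulCoeff x).sum (fun p r => r * ((if p.1 = c then 1 else 0) * g p.2)) =
      ∑ᶠ z, dualHallNum c z x * g z := by
  rw [Finsupp.sum, finsum_eq_sum_of_support_subset (s := (comulCoeff x).support.image Prod.snd)]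
  · simp only [mul_ite, ite_mul, one_mul, mul_zero, zero_mul]
    rw [← Finset.sum_filter]
    refine Finset.sum_of_injOn Prod.snd ?_ ?_ ?_ ?_
    · rintro ⟨p, q⟩ hp ⟨p', q'⟩ hq h
      simp only [Finset.coe_filter, Set.mem_ofPred_eq] at hp hq
      exact Prod.ext (hp.2.trans hq.2.symm) h
    · intro p hp
      exact Finset.mem_image_of_mem _ (Finset.mem_filter.1 hp).1
    · intro z _ hz
      by_contra h
      refine hz ⟨(c, z), Finset.mem_filter.2 ⟨?_, rfl⟩, rfl⟩
      exact Finsupp.mem_support_iff.2 (left_ne_zero_of_mul h)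
    · rintro ⟨p, q⟩ hp
      obtain rfl : p = c := (Finset.mem_filter.1 hp).2
      rfl
  · intro z hz
    exact Finset.mem_image.2 ⟨(c, z), Finsupp.mem_support_iff.2 (left_ne_zero_of_mul hz), rfl⟩

/-- The Hall algebra of a cofinitary exact category, as a coalgebra. -/
noncomputable instance : Coalgebra ℚ (HallAlgebra C) where
  coassoc := by
    classical
    refine hom_ext fun y => (equiv₃ C).injective (Finsupp.ext ?_)
    rintro ⟨a, b, c⟩
    simp only [LinearMap.comp_apply, LinearEquiv.coe_coe, comul_of]
    have h₁ : equiv₃ C (TensorProduct.assoc ℚ _ _ _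
        (CoalgebraStruct.comul.rTensor (HallAlgebra C) (basisComul y))) (a, (b, c)) =
        ∑ᶠ z, dualHallNum z c y * dualHallNum a b z := by
      rw [← sum_comulCoeff_fst, basisComul]
      simp only [Finsupp.sum, map_sum, map_smul, LinearMap.rTensor_tmul, comul_of,
        Finsupp.finsetSum_apply, Finsupp.smul_apply, equiv₃_assoc_tmul, equiv₂_basisComul,
        coeff_of, smul_eq_mul]
    have h₂ : equiv₃ C (CoalgebraStruct.comul.lTensor (HallAlgebra C) (basisComul y))
        (a, (b, c)) = ∑ᶠ z, dualHallNum a z y * dualHallNum b c z := by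
      rw [← sum_comulCoeff_snd, basisComul]
      simp only [Finsupp.sum, map_sum, map_smul, LinearMap.lTensor_tmul, comul_of,
        Finsupp.finsetSum_apply, Finsupp.smul_apply, equiv₃_tmul, equiv₂_basisComul,
        coeff_of, smul_eq_mul]
    rw [h₁, h₂, dualHallNum_coassoc]
  rTensor_counit_comp_comul := by
    classical
    refine hom_ext fun y => (TensorProduct.lid ℚ _).injective (ext fun b => ?_)
    have h : ∑ᶠ z, dualHallNum (zeroCls C) z y * (if z = b then 1 else 0 : ℚ) =
        if y = b then 1 else 0 := by
      rw [finsum_eq_single _ b (fun z hz => by simp [hz]), dualHallNum_zero_left]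
      simp [eq_comm]
    rw [← sum_comulCoeff_snd, Finsupp.sum] at h
    simp only [LinearMap.comp_apply, comul_of, basisComul, Finsupp.sum, map_sum, map_smul,
      LinearMap.rTensor_tmul, counit_of, TensorProduct.lid_tmul, coeff_of, smul_eq_mul,
      TensorProduct.mk_apply, one_smul]
    exact h
  lTensor_counit_comp_comul := by
    classical
    refine hom_ext fun y => (TensorProduct.rid ℚ _).injective (ext fun b => ?_)
    have h : ∑ᶠ z, dualHallNum z (zeroCls C) y * (if z = b then 1 else 0 : ℚ) =
        if y = b then 1 else 0 := by
      rw [finsum_eq_single _ b (fun z hz => by simp [hz]), dualHallNum_zero_right]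
      simp [eq_comm]
    rw [← sum_comulCoeff_fst, Finsupp.sum] at h
    simp only [LinearMap.comp_apply, comul_of, basisComul, Finsupp.sum, map_sum, map_smul,
      LinearMap.lTensor_tmul, counit_of, TensorProduct.rid_tmul, coeff_of, smul_eq_mul,
      LinearMap.flip_apply, TensorProduct.mk_apply, one_smul]
    convert h using 2
    ring

end Coproduct

end HallAlgebra

end HallAlgebra

section QuasiNichols

variable (F A : Type*) [Field F] [Ring A] [Algebra F A] [Coalgebra F A]

/-- The space of primitive elements of a unital algebra that is also a coalgebra. -/
def primitives : Submodule F A where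
  carrier := {c | CoalgebraStruct.comul (R := F) c = c ⊗ₜ[F] 1 + 1 ⊗ₜ[F] c}
  zero_mem' := by simp
  add_mem' := fun {a b} ha hb => by
    change CoalgebraStruct.comul (R := F) (a + b) = _
    rw [map_add, show CoalgebraStruct.comul (R := F) a = _ from ha,
      show CoalgebraStruct.comul (R := F) b = _ from hb, TensorProduct.add_tmul,
      TensorProduct.tmul_add]
    abel
  smul_mem' := fun r a ha => by
    change CoalgebraStruct.comul (R := F) (r • a) = _
    rw [map_smul, show CoalgebraStruct.comul (R := F) a = _ from ha, smul_add,
      TensorProduct.smul_tmul', TensorProduct.tmul_smul]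

/-- The sum of the powers `V ^ r` with `r > 1`, that is, the space of all sums of products of at
least two elements of `V`. -/
def higherPowers {F A : Type*} [Field F] [Ring A] [Algebra F A] (V : Submodule F A) :
    Submodule F A :=
  ⨆ (r : ℕ) (_ : 1 < r), V ^ r

/-- A quasi-Nichols algebra: `A = F ⊕ V ⊕ (∑_{r > 1} V ^ r)` with `V` the space of primitive
elements, an internal direct sum whose first summand is a copy of `F` spanned by the unit. -/
def IsQuasiNichols : Prop :=
  Function.Injective (algebraMap F A) ∧
    DirectSum.IsInternal
      ![(1 : Submodule F A), primitives F A, higherPowers (primitives F A)]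

end QuasiNichols

end Hall

/-!
The form `⟨[A], [B]⟩ = δ_{[A],[B]} / #Aut A` on the Hall algebra `H` is positive definite, and the
normalisation of the dual Hall numbers makes the coproduct adjoint to the opposite of the
product: the coefficient of `Δ(v)` at `[A] ⊗ [B]` is `⟨v, [B][A]⟩` up to the nonzero factor
`#Aut A · #Aut B` (`equiv₂_comul`). Let `H₊` be the span of the classes of nonzero objects. It is
closed under multiplication, because the zero object has no nonzero quotients, and an element is
primitive exactly when it is orthogonal to `1` and to `H₊²` (`mem_primitives_iff`).

Since `V ⊆ H₊`, the higher powers of the space `V` of primitive elements lie in `H₊²`. So `ℚ · 1`,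
`V` and `∑_{r > 1} V ^ r` are pairwise orthogonal, and therefore independent by definiteness; in
particular `V` meets the last of them in `0`.

For generation, `H` is graded by the Grothendieck monoid, with finite-dimensional components as the
category is profinitary. Projecting `[X]` orthogonally inside its component writes it as a primitive
element plus a combination of `1` and of products `[A][B]` with `A` and `B` nonzero and `A ⊞ B` in
the Grothendieck class of `X` (`exists_primitive_add_decomposable`). This recursion ends: the
largest number of endomorphisms of an object in a Grothendieck class drops strictly from the class
of `A ⊞ B` to those of `A` and of `B` (`maxEndCard_lt`). That step uses that replacing `A` by an
object of the same Grothendieck class does not change the class of `A ⊞ B`.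
-/

namespace Hall

/-! ### Direct sums and Grothendieck classes -/

section DirectSums

variable {C : Type*} [Category C] [Preadditive C] [HasZeroObject C] [HasBinaryBiproducts C]
  [ExactStructure C]

lemma isPullback_biprod_map_id {C : Type*} [Category C] [Preadditive C] [HasBinaryBiproducts C]
    {X A : C} (g : X ⟶ A) (Z : C) :
    IsPullback (biprod.fst : X ⊞ Z ⟶ X) (biprod.map g (𝟙 Z)) g biprod.fst := by
  refine ⟨⟨by simp⟩, ⟨PullbackCone.IsLimit.mk _
    (fun s => biprod.lift s.fst (s.snd ≫ biprod.snd)) (fun s => by simp) (fun s => ?_)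
    (fun s u h₁ h₂ => ?_)⟩⟩
  · apply biprod.hom_ext
    · simp [s.condition]
    · simp
  · apply biprod.hom_ext
    · simp [h₁]
    · simp [← h₂]

/-- A short exact sequence `B ⟶ X ⟶ A` stays exact when `Z` is added to `X` and `A`. -/
lemma IsConfl.biprod {B X A : C} {f : B ⟶ X} {g : X ⟶ A} (h : IsConfl f g) (Z : C) :
    IsConfl (f ≫ (biprod.inl : X ⟶ X ⊞ Z)) (biprod.map g (𝟙 Z)) := by
  have := h.mono
  refine (h.deflation.of_isPullback (isPullback_biprod_map_id g Z)).isConfl_of_kernel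
    (by simp [reassoc_of% h.zero]) inferInstance fun u hu => ?_
  obtain ⟨v, hv⟩ := h.lift (u ≫ biprod.fst) (by simpa using hu =≫ biprod.fst)
  refine ⟨v, ?_⟩
  apply biprod.hom_ext
  · simp [hv]
  · simpa using (hu =≫ biprod.snd).symm

lemma isConfl_inr_fst (A B : C) :
    IsConfl (biprod.inr : B ⟶ A ⊞ B) (biprod.fst : A ⊞ B ⟶ A) := by
  have h := (isConfl_zero_right (Iso.refl B) (isZero_zero C)).biprod A
  refine h.of_iso (Iso.refl _) (biprod.braiding B A)
    ⟨biprod.snd, biprod.inr, biprod.hom_ext _ _ ((isZero_zero C).eq_of_tgt _ _) (by simp),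
      by simp⟩ ?_ ?_
  · apply biprod.hom_ext <;> simp
  · simp

lemma cls_biprod_mem_extClasses (A B : C) : cls (A ⊞ B) ∈ extClasses A B :=
  ⟨A ⊞ B, rfl, ⟨(biprod.inr, biprod.fst), isConfl_inr_fst A B⟩⟩

lemma cls_biprod_mem_extClasses_of_mem {M N X : C} (h : cls X ∈ extClasses M N) (Z : C) :
    cls (X ⊞ Z) ∈ extClasses (M ⊞ Z) N := by
  obtain ⟨X', hX, ⟨f, g⟩, hfg⟩ := h
  obtain ⟨e⟩ := cls_eq_iff.1 hX
  exact ⟨X' ⊞ Z, cls_eq_iff.2 ⟨biprod.mapIso e (Iso.refl Z)⟩, ⟨(f ≫ biprod.inl, biprod.map g (𝟙 Z)),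
    IsConfl.biprod hfg Z⟩⟩

/-- Equality in the Grothendieck monoid is stable under direct sums. -/
lemma grothendieckClass_biprod_congr {X Y : C}
    (h : grothendieckClass (cls X) = grothendieckClass (cls Y)) (Z : C) :
    grothendieckClass (cls (X ⊞ Z)) = grothendieckClass (cls (Y ⊞ Z)) := by
  have hrep (X : C) : cls (rep (cls X) ⊞ Z) = cls (X ⊞ Z) :=
    cls_eq_iff.2 ⟨biprod.mapIso (nonempty_iso_rep X).some (Iso.refl Z)⟩
  let F : GrothendieckMonoid C → GrothendieckMonoid C :=
    Quot.lift (fun x => grothendieckClass (cls (rep x ⊞ Z))) (by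
      rintro x y ⟨M, N, hx, hy⟩
      rw [← cls_rep x] at hx
      rw [← cls_rep y] at hy
      exact Quot.sound ⟨M ⊞ Z, N, cls_biprod_mem_extClasses_of_mem hx Z,
        cls_biprod_mem_extClasses_of_mem hy Z⟩)
  have hF := congrArg F h
  change grothendieckClass (cls (rep (cls X) ⊞ Z)) =
    grothendieckClass (cls (rep (cls Y) ⊞ Z)) at hF
  rwa [hrep, hrep] at hF

end DirectSums

section EndomorphismCounts

lemma two_le_card_end {C : Type*} [Category C] [Preadditive C] [HomFinite C] {X : C}
    (hX : ¬ IsZero X) : 2 ≤ Nat.card (X ⟶ X) := by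
  have : Nontrivial (X ⟶ X) := ⟨𝟙 X, 0, fun h => hX ((IsZero.iff_id_eq_zero X).2 h)⟩
  exact Finite.one_lt_card

lemma card_end_mul_card_end_le {C : Type*} [Category C] [Preadditive C] [HasBinaryBiproducts C]
    [HomFinite C] (X Y : C) :
    Nat.card (X ⟶ X) * Nat.card (Y ⟶ Y) ≤ Nat.card (X ⊞ Y ⟶ X ⊞ Y) := by
  rw [← Nat.card_prod]
  refine Nat.card_le_card_of_injective
    (fun p : (X ⟶ X) × (Y ⟶ Y) => biprod.map p.1 p.2) ?_
  rintro ⟨a, b⟩ ⟨a', b'⟩ h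
  have h₁ := biprod.inl ≫= h =≫ biprod.fst
  have h₂ := biprod.inr ≫= h =≫ biprod.snd
  simp at h₁ h₂
  rw [h₁, h₂]

lemma not_isZero_rep {C : Type*} [Category C] [HasZeroObject C] {b : IsoClass C}
    (hb : b ≠ zeroCls C) : ¬ IsZero (rep b) :=
  fun h => hb (eq_of_iso_rep (h.iso isZero_rep_zeroCls))

variable {C : Type*} [Category C] [Preadditive C] [HasZeroObject C] [HasBinaryBiproducts C]
  [ExactStructure C] [Profinitary C]

/-- The largest number of endomorphisms of an object in a Grothendieck class. -/
noncomputable def maxEndCard (γ : GrothendieckMonoid C) : ℕ :=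
  (Profinitary.finite_class γ).toFinset.sup fun y => Nat.card (rep y ⟶ rep y)

/-- Adding a nonzero object at least doubles the number of endomorphisms, and it does so for all
members of a Grothendieck class at once. -/
lemma maxEndCard_lt {a b : IsoClass C} (hb : b ≠ zeroCls C) :
    maxEndCard (grothendieckClass a) < maxEndCard (grothendieckClass (cls (rep a ⊞ rep b))) := by
  obtain ⟨a', ha', h⟩ := Finset.exists_mem_eq_sup
    (Profinitary.finite_class (grothendieckClass a)).toFinset
    ⟨a, by simp⟩ fun y => Nat.card (rep y ⟶ rep y)
  have hab : grothendieckClass (cls (rep a' ⊞ rep b)) =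
      grothendieckClass (cls (rep a ⊞ rep b)) :=
    grothendieckClass_biprod_congr (by simpa using ha') _
  have hle : Nat.card (rep (cls (rep a' ⊞ rep b)) ⟶ rep (cls (rep a' ⊞ rep b))) ≤
      maxEndCard (grothendieckClass (cls (rep a ⊞ rep b))) :=
    Finset.le_sup (f := fun y => Nat.card (rep y ⟶ rep y)) (by simpa using hab)
  have hiso : Nat.card (rep (cls (rep a' ⊞ rep b)) ⟶ rep (cls (rep a' ⊞ rep b))) =
      Nat.card (rep a' ⊞ rep b ⟶ rep a' ⊞ rep b) :=
    have e := (nonempty_iso_rep (rep a' ⊞ rep b)).some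
    Nat.card_congr (e.homCongr e)
  rw [maxEndCard, h]
  have h₁ := card_end_mul_card_end_le (rep a') (rep b)
  have h₂ := two_le_card_end (not_isZero_rep hb)
  have h₃ : 0 < Nat.card (rep a' ⟶ rep a') := Nat.card_pos
  rw [hiso] at hle
  nlinarith

end EndomorphismCounts

/-! ### Positive definite forms -/

/-- Orthogonal projection of a vector to a finite-dimensional subspace on which a bilinear form is
anisotropic. -/
lemma exists_mem_forall_apply_sub_eq_zero {K V : Type*} [Field K] [AddCommGroup V] [Module K V]
    (B : LinearMap.BilinForm K V) (U : Submodule K V) [FiniteDimensional K U]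
    (hB : ∀ u ∈ U, B u u = 0 → u = 0) (x : V) : ∃ u ∈ U, ∀ w ∈ U, B (x - u) w = 0 := by
  -- `B` embeds `U` into its dual, hence onto it, so `B x` restricted to `U` is some `B u`.
  let φ : U →ₗ[K] Module.Dual K U := U.dualRestrict ∘ₗ B ∘ₗ U.subtype
  have hφ : Function.Injective φ := by
    refine (injective_iff_map_eq_zero φ).2 fun u hu => Subtype.ext (hB u u.2 ?_)
    exact LinearMap.congr_fun hu u
  obtain ⟨u, hu⟩ := (LinearMap.injective_iff_surjective_of_finrank_eq_finrank
    Subspace.dual_finrank_eq.symm).1 hφ (U.dualRestrict (B x))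
  refine ⟨u, u.2, fun w hw => ?_⟩
  have h : B u w = B x w := LinearMap.congr_fun hu ⟨w, hw⟩
  rw [map_sub, LinearMap.sub_apply, h, sub_self]

namespace HallAlgebra

section Pairing

variable {C : Type*} [Category C]

/-- The symmetric bilinear form `⟨[A], [B]⟩ = δ_{[A],[B]} / #Aut A`. -/
noncomputable def pairing : HallAlgebra C →ₗ[ℚ] HallAlgebra C →ₗ[ℚ] ℚ :=
  lift fun x => (autCard (rep x))⁻¹ • coeff x

lemma pairing_of_left (x : IsoClass C) (v : HallAlgebra C) :
    pairing (of x) v = (autCard (rep x))⁻¹ * coeff x v := by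
  simp [pairing]

lemma pairing_of_of_of_ne {x y : IsoClass C} (h : x ≠ y) : pairing (of x) (of y) = 0 := by
  classical
  simp [pairing_of_left, coeff_of, h.symm]

lemma pairing_comm (u v : HallAlgebra C) : pairing u v = pairing v u := by
  have h : pairing (C := C) = pairing.flip := hom_ext fun x => hom_ext fun y => by
    rw [LinearMap.flip_apply]
    by_cases hxy : x = y
    · rw [hxy]
    · rw [pairing_of_of_of_ne hxy, pairing_of_of_of_ne (Ne.symm hxy)]
  exact LinearMap.congr_fun₂ h u v

lemma pairing_eq_finsum (u v : HallAlgebra C) :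
    pairing u v = ∑ᶠ x, coeff x u * ((autCard (rep x))⁻¹ * coeff x v) := by
  rw [← lift_eq_finsum_mul]
  have h : (pairing (C := C)).flip v = lift fun x => (autCard (rep x))⁻¹ * coeff x v :=
    hom_ext fun x => by simp [pairing_of_left]
  exact LinearMap.congr_fun h u

/-- The form is positive definite, hence anisotropic. -/
lemma eq_zero_of_pairing_self [HomFinite C] {u : HallAlgebra C} (h : pairing u u = 0) :
    u = 0 := by
  have hpos (x : IsoClass C) : 0 < (autCard (rep x))⁻¹ :=
    inv_pos.2 (lt_of_le_of_ne (by simp [autCard]) (autCard_ne_zero _).symm)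
  have hnonneg (x : IsoClass C) : 0 ≤ coeff x u * ((autCard (rep x))⁻¹ * coeff x u) := by
    rw [mul_left_comm]
    exact mul_nonneg (hpos x).le (mul_self_nonneg _)
  have hfin : (Function.support fun x : IsoClass C =>
      coeff x u * ((autCard (rep x))⁻¹ * coeff x u)).Finite :=
    (equiv C u).support.finite_toSet.subset fun x hx =>
      Finsupp.mem_support_iff.2 (left_ne_zero_of_mul hx)
  refine ext fun x => ?_
  have hle := single_le_finsum x hfin hnonneg
  rw [← pairing_eq_finsum, h] at hle
  have h0 := le_antisymm hle (hnonneg x)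
  simpa [(hpos x).ne'] using h0

lemma mem_span_of {S : Set (IsoClass C)} {u : HallAlgebra C}
    (h : ∀ x, coeff x u ≠ 0 → x ∈ S) : u ∈ Submodule.span ℚ (of '' S) := by
  have hu : u = ∑ x ∈ (equiv C u).support, coeff x u • of x := by
    apply (equiv C).injective
    conv_lhs => rw [← Finsupp.sum_single (equiv C u)]
    simp [Finsupp.sum, of, coeff]
  rw [hu]
  exact Submodule.sum_mem _ fun x hx => Submodule.smul_mem _ _
    (Submodule.subset_span ⟨x, h x (Finsupp.mem_support_iff.1 hx), rfl⟩)

lemma pairing_eq_zero_of_disjoint {S T : Set (IsoClass C)} (h : Disjoint S T)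
    {u v : HallAlgebra C} (hu : u ∈ Submodule.span ℚ (of '' S))
    (hv : v ∈ Submodule.span ℚ (of '' T)) : pairing u v = 0 := by
  induction hu using Submodule.span_induction with
  | zero => simp
  | add a b _ _ ha hb => rw [map_add, LinearMap.add_apply, ha, hb, add_zero]
  | smul r a _ ha => rw [map_smul, LinearMap.smul_apply, ha, smul_zero]
  | mem a ha =>
    obtain ⟨x, hx, rfl⟩ := ha
    induction hv using Submodule.span_induction with
    | zero => simp
    | add a b _ _ ha hb => rw [map_add, ha, hb, add_zero]
    | smul r a _ ha => rw [map_smul, ha, smul_zero]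
    | mem b hb =>
      obtain ⟨y, hy, rfl⟩ := hb
      exact pairing_of_of_of_ne fun hxy => Set.disjoint_left.1 h hx (hxy ▸ hy)

end Pairing

/-! ### Primitive elements as an orthogonal complement -/

section Augmentation

variable {C : Type*} [Category C] [Preadditive C] [HasZeroObject C] [HasBinaryBiproducts C]
  [ExactStructure C]

/-- The span of the classes of nonzero objects, which is the kernel of the counit. -/
noncomputable def augmentation (C : Type*) [Category C] [HasZeroObject C] :
    Submodule ℚ (HallAlgebra C) :=
  Submodule.span ℚ (of '' {x | x ≠ zeroCls C})

lemma mem_augmentation_of_coeff {C : Type*} [Category C] [HasZeroObject C] {u : HallAlgebra C}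
    (h : coeff (zeroCls C) u = 0) : u ∈ augmentation C :=
  mem_span_of fun x hx h' => hx (by rw [h', h])

lemma pairing_one_left {C : Type*} [Category C] [HasZeroObject C] (v : HallAlgebra C) :
    pairing 1 v = coeff (zeroCls C) v := by
  rw [one_def, pairing_of_left, autCard_of_isZero isZero_rep_zeroCls, inv_one, one_mul]

lemma pairing_one_of_mem_augmentation {C : Type*} [Category C] [HasZeroObject C]
    {u : HallAlgebra C} (h : u ∈ augmentation C) : pairing 1 u = 0 :=
  pairing_eq_zero_of_disjoint (S := {zeroCls C}) (by simp)
    (Submodule.subset_span ⟨_, rfl, rfl⟩) h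

/-- The zero object is not the middle term of a short exact sequence with nonzero quotient. -/
lemma hallNum_zeroCls {a : IsoClass C} (ha : a ≠ zeroCls C) (b : IsoClass C) :
    hallNum a b (zeroCls C) = 0 := by
  by_contra h
  obtain ⟨⟨f, g⟩, hfg⟩ := nonempty_of_hallNum_ne_zero h
  have hfg : IsConfl f g := hfg
  have := hfg.epi
  exact not_isZero_rep ha (IsZero.of_epi g isZero_rep_zeroCls)

lemma coeff_of_mul_of [Finitary C] (a b x : IsoClass C) :
    coeff x (of a * of b) = hallNum a b x := by
  rw [mul_def, mulHom_of_of, coeff_basisMul]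

lemma augmentation_mul_eq_span [Finitary C] :
    augmentation C * augmentation C = Submodule.span ℚ
      {u | ∃ a b : IsoClass C, a ≠ zeroCls C ∧ b ≠ zeroCls C ∧ of a * of b = u} := by
  rw [augmentation, Submodule.span_mul_span]
  congr 1
  ext u
  simp only [Set.mem_mul, Set.mem_image]
  constructor
  · rintro ⟨_, ⟨a, ha, rfl⟩, _, ⟨b, hb, rfl⟩, rfl⟩
    exact ⟨a, b, ha, hb, rfl⟩
  · rintro ⟨a, b, ha, hb, rfl⟩
    exact ⟨_, ⟨a, ha, rfl⟩, _, ⟨b, hb, rfl⟩, rfl⟩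

lemma augmentation_mul_le [Finitary C] :
    augmentation C * augmentation C ≤ augmentation C := by
  rw [augmentation_mul_eq_span, Submodule.span_le]
  rintro _ ⟨a, b, ha, -, rfl⟩
  exact mem_augmentation_of_coeff (by rw [coeff_of_mul_of, hallNum_zeroCls ha])

end Augmentation

section Primitive

variable {C : Type*} [Category C] [Preadditive C] [HasZeroObject C] [HasBinaryBiproducts C]
  [ExactStructure C] [Finitary C] [Cofinitary C]

/-- Up to the factors coming from the form, the coproduct is adjoint to the opposite product. -/
lemma equiv₂_comul (v : HallAlgebra C) (a b : IsoClass C) :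
    equiv₂ C (CoalgebraStruct.comul (R := ℚ) v) (a, b) =
      autCard (rep a) * autCard (rep b) * pairing v (of b * of a) := by
  have h : Finsupp.lapply (a, b) ∘ₗ (equiv₂ C).toLinearMap ∘ₗ CoalgebraStruct.comul (R := ℚ) =
      (autCard (rep a) * autCard (rep b)) • (pairing (C := C)).flip (of b * of a) :=
    hom_ext fun x => by
      simp only [LinearMap.comp_apply, LinearEquiv.coe_coe, Finsupp.lapply_apply, comul_of,
        equiv₂_basisComul, LinearMap.smul_apply, LinearMap.flip_apply, pairing_of_left,
        coeff_of_mul_of, smul_eq_mul]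
      rw [dualHallNum, dualHallNumber, hallNum]
      ring
  exact LinearMap.congr_fun h v

/-- An element is primitive if and only if it is orthogonal to the unit and to all products of two
classes of nonzero objects. -/
lemma mem_primitives_iff {v : HallAlgebra C} :
    v ∈ primitives ℚ (HallAlgebra C) ↔ v ∈ augmentation C ∧
      ∀ a b, a ≠ zeroCls C → b ≠ zeroCls C → pairing v (of a * of b) = 0 := by
  classical
  have key : v ∈ primitives ℚ (HallAlgebra C) ↔ ∀ a b : IsoClass C,
      autCard (rep a) * autCard (rep b) * pairing v (of b * of a) =
        coeff a v * (if zeroCls C = b then 1 else 0) +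
          (if zeroCls C = a then 1 else 0) * coeff b v := by
    change CoalgebraStruct.comul (R := ℚ) v = v ⊗ₜ[ℚ] 1 + 1 ⊗ₜ[ℚ] v ↔ _
    rw [← (equiv₂ C).injective.eq_iff, Finsupp.ext_iff, Prod.forall]
    simp only [equiv₂_comul, map_add, Finsupp.add_apply, equiv₂_tmul, one_def, coeff_of]
  have hone (a : IsoClass C) : autCard (rep a) * pairing v (of a) = coeff a v := by
    rw [pairing_comm, pairing_of_left, mul_inv_cancel_left₀ (autCard_ne_zero _)]
  have hcard : autCard (rep (zeroCls C)) = 1 := autCard_of_isZero isZero_rep_zeroCls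
  rw [key]
  -- The equations with `a` or `b` zero only say that the coefficient at the zero object vanishes.
  constructor
  · refine fun h => ⟨mem_augmentation_of_coeff ?_, fun a b ha hb => ?_⟩
    · have h0 := h (zeroCls C) (zeroCls C)
      rw [← one_def, mul_one, pairing_comm, pairing_one_left, hcard, if_pos rfl] at h0
      linarith
    · have h0 := h b a
      rw [if_neg ha.symm, if_neg hb.symm] at h0
      simpa [autCard_ne_zero] using h0
  · rintro ⟨h0, h⟩ a b
    replace h0 : coeff (zeroCls C) v = 0 := by
      rw [← pairing_one_left, pairing_one_of_mem_augmentation h0]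
    by_cases ha : zeroCls C = a
    · subst ha
      rw [← one_def, mul_one, hcard, one_mul, hone]
      simp [h0]
    · by_cases hb : zeroCls C = b
      · subst hb
        rw [← one_def, one_mul, hcard, mul_one, hone]
        simp [h0]
      · rw [h b a (Ne.symm hb) (Ne.symm ha), if_neg ha, if_neg hb]
        simp

lemma primitives_le_augmentation : primitives ℚ (HallAlgebra C) ≤ augmentation C :=
  fun _ hv => (mem_primitives_iff.1 hv).1

lemma pairing_of_mem_augmentation_mul {v u : HallAlgebra C}
    (hv : v ∈ primitives ℚ (HallAlgebra C)) (hu : u ∈ augmentation C * augmentation C) :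
    pairing v u = 0 := by
  rw [augmentation_mul_eq_span] at hu
  induction hu using Submodule.span_induction with
  | zero => simp
  | add a b _ _ ha hb => rw [map_add, ha, hb, add_zero]
  | smul r a _ ha => rw [map_smul, ha, smul_zero]
  | mem a ha =>
    obtain ⟨x, y, hx, hy, rfl⟩ := ha
    exact (mem_primitives_iff.1 hv).2 x y hx hy

lemma higherPowers_primitives_le :
    higherPowers (primitives ℚ (HallAlgebra C)) ≤ augmentation C * augmentation C := by
  have hpow (n : ℕ) : primitives ℚ (HallAlgebra C) ^ (n + 1) ≤ augmentation C := by
    induction n with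
    | zero => simpa using primitives_le_augmentation
    | succ n ih =>
      rw [pow_succ]
      exact (mul_le_mul' ih primitives_le_augmentation).trans augmentation_mul_le
  refine iSup₂_le fun r hr => ?_
  obtain ⟨n, rfl⟩ := Nat.exists_eq_add_of_le' hr
  rw [pow_succ]
  exact mul_le_mul' (hpow n) primitives_le_augmentation

end Primitive

/-! ### Generation by primitive elements -/

section Generation

variable {C : Type*} [Category C] [Preadditive C] [HasZeroObject C] [HasBinaryBiproducts C]
  [ExactStructure C]

/-- The homogeneous component of the Hall algebra in a degree of the Grothendieck monoid. -/
noncomputable def homogeneous (γ : GrothendieckMonoid C) : Submodule ℚ (HallAlgebra C) :=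
  Submodule.span ℚ (of '' {x | grothendieckClass x = γ})

instance [Profinitary C] (γ : GrothendieckMonoid C) : FiniteDimensional ℚ (homogeneous γ) :=
  FiniteDimensional.span_of_finite ℚ ((Profinitary.finite_class γ).image of)

lemma of_mem_homogeneous (x : IsoClass C) : of x ∈ homogeneous (grothendieckClass x) :=
  Submodule.subset_span ⟨x, rfl, rfl⟩

lemma pairing_homogeneous_of_ne {γ δ : GrothendieckMonoid C} (h : γ ≠ δ) {u v : HallAlgebra C}
    (hu : u ∈ homogeneous γ) (hv : v ∈ homogeneous δ) : pairing u v = 0 :=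
  pairing_eq_zero_of_disjoint (Set.disjoint_left.2 fun _ h₁ h₂ => h (h₁.symm.trans h₂)) hu hv

/-- All middle terms of short exact sequences with given end terms have the Grothendieck class of
the split one, so that the Hall product is graded. -/
lemma of_mul_of_mem_homogeneous [Finitary C] (a b : IsoClass C) :
    of a * of b ∈ homogeneous (grothendieckClass (cls (rep a ⊞ rep b))) := by
  refine mem_span_of fun x hx => ?_
  rw [coeff_of_mul_of] at hx
  exact Quot.sound ⟨rep a, rep b, ⟨rep x, cls_rep x, nonempty_of_hallNum_ne_zero hx⟩,
    cls_biprod_mem_extClasses _ _⟩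

/-- The unit, if it has degree `γ`, and the products of degree `γ` of two classes of nonzero
objects. -/
def decomposables [Finitary C] (γ : GrothendieckMonoid C) : Set (HallAlgebra C) :=
  {u | (grothendieckClass (zeroCls C) = γ ∧ 1 = u) ∨
    ∃ a b : IsoClass C, a ≠ zeroCls C ∧ b ≠ zeroCls C ∧
      grothendieckClass (cls (rep a ⊞ rep b)) = γ ∧ of a * of b = u}

lemma span_decomposables_le [Finitary C] (γ : GrothendieckMonoid C) :
    Submodule.span ℚ (decomposables γ) ≤ homogeneous γ := by
  rw [Submodule.span_le]
  rintro _ (⟨rfl, rfl⟩ | ⟨a, b, -, -, rfl, rfl⟩)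
  · exact of_mem_homogeneous _
  · exact of_mul_of_mem_homogeneous a b

variable [Profinitary C] [Cofinitary C]

/-- Orthogonality to the decomposable elements of the same degree suffices for a homogeneous
element to be primitive, since different degrees are orthogonal. -/
lemma mem_primitives_of_homogeneous {γ : GrothendieckMonoid C} {v : HallAlgebra C}
    (hv : v ∈ homogeneous γ)
    (h : ∀ w ∈ decomposables γ, pairing v w = 0) : v ∈ primitives ℚ (HallAlgebra C) := by
  refine mem_primitives_iff.2 ⟨mem_augmentation_of_coeff ?_, fun a b ha hb => ?_⟩
  · rw [← pairing_one_left, pairing_comm]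
    by_cases hγ : grothendieckClass (zeroCls C) = γ
    · exact h 1 (Or.inl ⟨hγ, rfl⟩)
    · exact pairing_homogeneous_of_ne (Ne.symm hγ) hv (of_mem_homogeneous _)
  · by_cases hγ : grothendieckClass (cls (rep a ⊞ rep b)) = γ
    · exact h _ (Or.inr ⟨a, b, ha, hb, hγ, rfl⟩)
    · exact pairing_homogeneous_of_ne (Ne.symm hγ) hv (of_mul_of_mem_homogeneous a b)

lemma exists_primitive_add_decomposable (x : IsoClass C) :
    ∃ v ∈ primitives ℚ (HallAlgebra C),
      ∃ u ∈ Submodule.span ℚ (decomposables (grothendieckClass x)), of x = v + u := by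
  have hle := span_decomposables_le (grothendieckClass x)
  have : FiniteDimensional ℚ (Submodule.span ℚ (decomposables (grothendieckClass x))) :=
    Submodule.finiteDimensional_of_le hle
  obtain ⟨u, hu, h⟩ := exists_mem_forall_apply_sub_eq_zero pairing
    (Submodule.span ℚ (decomposables (grothendieckClass x)))
    (fun u _ => eq_zero_of_pairing_self) (of x)
  exact ⟨of x - u, mem_primitives_of_homogeneous
    (Submodule.sub_mem _ (of_mem_homogeneous x) (hle hu))
    fun w hw => h w (Submodule.subset_span hw), u, hu, (sub_add_cancel _ _).symm⟩

lemma of_mem_adjoin_primitives (x : IsoClass C) :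
    of x ∈ Algebra.adjoin ℚ (primitives ℚ (HallAlgebra C) : Set (HallAlgebra C)) := by
  induction hn : maxEndCard (grothendieckClass x) using Nat.strong_induction_on generalizing x with
  | _ n ih =>
  obtain ⟨v, hv, u, hu, hx⟩ := exists_primitive_add_decomposable x
  rw [hx]
  refine add_mem (Algebra.subset_adjoin hv) ?_
  refine (Submodule.span_le (p := Subalgebra.toSubmodule
    (Algebra.adjoin ℚ (primitives ℚ (HallAlgebra C) : Set (HallAlgebra C))))).2 ?_ hu
  rintro _ (⟨-, rfl⟩ | ⟨a, b, ha, hb, hab, rfl⟩)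
  · exact Subalgebra.one_mem _
  · have hcomm : cls (rep b ⊞ rep a) = cls (rep a ⊞ rep b) :=
      cls_eq_iff.2 ⟨biprod.braiding _ _⟩
    have h₁ := maxEndCard_lt (a := a) hb
    have h₂ := maxEndCard_lt (a := b) ha
    rw [hab, hn] at h₁
    rw [hcomm, hab, hn] at h₂
    exact Subalgebra.mul_mem _ (ih _ h₁ a rfl) (ih _ h₂ b rfl)

lemma adjoin_primitives :
    Algebra.adjoin ℚ (primitives ℚ (HallAlgebra C) : Set (HallAlgebra C)) = ⊤ := by
  refine eq_top_iff.2 fun u _ => ?_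
  have hu : u ∈ Submodule.span ℚ (of '' (Set.univ : Set (IsoClass C))) :=
    mem_span_of fun _ _ => trivial
  refine (Submodule.span_le (p := Subalgebra.toSubmodule
    (Algebra.adjoin ℚ (primitives ℚ (HallAlgebra C) : Set (HallAlgebra C))))).2 ?_ hu
  rintro _ ⟨x, -, rfl⟩
  exact of_mem_adjoin_primitives x

end Generation

end HallAlgebra

/-! ### The decomposition -/

lemma adjoin_toSubmodule_le_sup_higherPowers {F A : Type*} [Field F] [Ring A] [Algebra F A]
    (V : Submodule F A) :
    Subalgebra.toSubmodule (Algebra.adjoin F (V : Set A)) ≤ 1 ⊔ (V ⊔ higherPowers V) := by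
  have hpow (x : A) (hx : x ∈ Submonoid.closure (V : Set A)) : ∃ r : ℕ, x ∈ V ^ r := by
    induction hx using Submonoid.closure_induction with
    | mem x hx => exact ⟨1, by simpa using hx⟩
    | one => exact ⟨0, by rw [pow_zero]; exact Submodule.one_le.1 le_rfl⟩
    | mul x y _ _ hx hy =>
      obtain ⟨r, hr⟩ := hx
      obtain ⟨s, hs⟩ := hy
      exact ⟨r + s, by rw [pow_add]; exact Submodule.mul_mem_mul hr hs⟩
  rw [Algebra.adjoin_eq_span, Submodule.span_le]
  intro x hx
  obtain ⟨r, hr⟩ := hpow x hx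
  match r, hr with
  | 0, hr => exact Submodule.mem_sup_left (by simpa using hr)
  | 1, hr => exact Submodule.mem_sup_right (Submodule.mem_sup_left (by simpa using hr))
  | r + 2, hr => exact Submodule.mem_sup_right (Submodule.mem_sup_right
      (Submodule.mem_iSup_of_mem (r + 2) (Submodule.mem_iSup_of_mem (by lia) hr)))

/-- Subspaces that are pairwise orthogonal for an anisotropic form are independent. -/
lemma iSupIndep_of_pairwise_orthogonal {K V ι : Type*} [Field K] [AddCommGroup V] [Module K V]
    (B : LinearMap.BilinForm K V) (hB : ∀ u, B u u = 0 → u = 0) (W : ι → Submodule K V)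
    (hW : ∀ i j, i ≠ j → ∀ u ∈ W i, ∀ v ∈ W j, B u v = 0) : iSupIndep W := by
  refine fun i => Submodule.disjoint_def.2 fun u hu hu' => hB u ?_
  have hle : ⨆ (j) (_ : j ≠ i), W j ≤ LinearMap.ker (B u) :=
    iSup₂_le fun j hj v hv => hW i j hj.symm u hu v hv
  exact hle hu'

section QuasiNichols

open HallAlgebra

variable {C : Type*} [Category C] [Preadditive C] [HasZeroObject C] [HasBinaryBiproducts C]
  [ExactStructure C]

lemma pairing_of_mem_one_of_mem_augmentation [Finitary C] {u v : HallAlgebra C}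
    (hu : u ∈ (1 : Submodule ℚ (HallAlgebra C))) (hv : v ∈ augmentation C) :
    pairing u v = 0 := by
  obtain ⟨r, rfl⟩ := Submodule.mem_one.1 hu
  rw [Algebra.algebraMap_eq_smul_one, map_smul, LinearMap.smul_apply,
    pairing_one_of_mem_augmentation hv, smul_zero]

lemma pairing_primitives_higherPowers [Finitary C] [Cofinitary C] {u v : HallAlgebra C}
    (hu : u ∈ primitives ℚ (HallAlgebra C))
    (hv : v ∈ higherPowers (primitives ℚ (HallAlgebra C))) : pairing u v = 0 :=
  pairing_of_mem_augmentation_mul hu (higherPowers_primitives_le hv)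

theorem HallAlgebra.isQuasiNichols [Profinitary C] [Cofinitary C] :
    IsQuasiNichols ℚ (HallAlgebra C) := by
  have h₂ := primitives_le_augmentation (C := C)
  have h₃ := higherPowers_primitives_le.trans (augmentation_mul_le (C := C))
  constructor
  · have : Nontrivial (HallAlgebra C) := ⟨1, 0, fun h => by
      classical
      simpa [one_def, coeff_of] using congrArg (coeff (zeroCls C)) h⟩
    exact (algebraMap ℚ (HallAlgebra C)).injective
  · rw [DirectSum.isInternal_submodule_iff_iSupIndep_and_iSup_eq_top]
    constructor
    · refine iSupIndep_of_pairwise_orthogonal pairing (fun u => eq_zero_of_pairing_self) _ ?_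
      have hsymm {U W : Submodule ℚ (HallAlgebra C)} (h : ∀ u ∈ U, ∀ v ∈ W, pairing u v = 0) :
          ∀ u ∈ W, ∀ v ∈ U, pairing u v = 0 :=
        fun u hu v hv => (pairing_comm u v).trans (h v hv u hu)
      have h₁₂ : ∀ u ∈ (1 : Submodule ℚ (HallAlgebra C)), ∀ v ∈ primitives ℚ (HallAlgebra C),
          pairing u v = 0 :=
        fun u hu v hv => pairing_of_mem_one_of_mem_augmentation hu (h₂ hv)
      have h₁₃ : ∀ u ∈ (1 : Submodule ℚ (HallAlgebra C)),
          ∀ v ∈ higherPowers (primitives ℚ (HallAlgebra C)), pairing u v = 0 :=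
        fun u hu v hv => pairing_of_mem_one_of_mem_augmentation hu (h₃ hv)
      have h₂₃ : ∀ u ∈ primitives ℚ (HallAlgebra C),
          ∀ v ∈ higherPowers (primitives ℚ (HallAlgebra C)), pairing u v = 0 :=
        fun u hu v hv => pairing_primitives_higherPowers hu hv
      intro i j hij
      fin_cases i <;> fin_cases j
      · exact absurd rfl hij
      · exact h₁₂
      · exact h₁₃
      · exact hsymm h₁₂
      · exact absurd rfl hij
      · exact h₂₃
      · exact hsymm h₁₃
      · exact hsymm h₂₃
      · exact absurd rfl hij
    · have h := adjoin_toSubmodule_le_sup_higherPowers (primitives ℚ (HallAlgebra C))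
      rw [adjoin_primitives, Algebra.top_toSubmodule] at h
      refine top_le_iff.1 (h.trans (sup_le ?_ (sup_le ?_ ?_)))
      · exact le_iSup ![(1 : Submodule ℚ (HallAlgebra C)), _, _] 0
      · exact le_iSup ![(1 : Submodule ℚ (HallAlgebra C)), _, _] 1
      · exact le_iSup ![(1 : Submodule ℚ (HallAlgebra C)), _, _] 2

end QuasiNichols

end Hall

theorem mainTheorem1 (C : Type*) [Category C] [Preadditive C] [HasZeroObject C]
    [HasBinaryBiproducts C] [Hall.ExactStructure C] [Hall.Profinitary C] [Hall.Cofinitary C] :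
    Algebra.adjoin ℚ (Hall.primitives ℚ (Hall.HallAlgebra C) : Set (Hall.HallAlgebra C)) = ⊤ ∧
      (∀ v ∈ Hall.primitives ℚ (Hall.HallAlgebra C),
        v ∈ Hall.higherPowers (Hall.primitives ℚ (Hall.HallAlgebra C)) → v = 0) ∧
      Hall.IsQuasiNichols ℚ (Hall.HallAlgebra C) :=
  ⟨Hall.HallAlgebra.adjoin_primitives, fun _ hv hv' =>
      Hall.HallAlgebra.eq_zero_of_pairing_self (Hall.pairing_primitives_higherPowers hv hv'),
    Hall.HallAlgebra.isQuasiNichols⟩
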